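/- **Model.** Let $T\ge 1$ be a number of periods, $p\ge 1$ a number of covariates and $k\in\{1,\dots,p\}$. On a probability space, let $(X_i,\alpha_i,\varepsilon_{i1},\dots,\varepsilon_{iT})_{i\ge 1}$ be i.i.d. across $i$, with $X_i=(X_{i1},\dots,X_{iT})$, $X_{it}\in\mathbb R^p$, $\alpha_i\in\mathbb R$. Assume that, for each $i$, the $(\varepsilon_{it})_{t}$ are i.i.d. with the logistic distribution (cdf $1/(1+e^{-z})$) and independent of $(\alpha_i,X_i)$, and that $Y_{it}=\mathbf 1\{X_{it}'\beta_0+\alpha_i+\varepsilon_{it}\ge 0\}$ for some $\beta_0\in\mathbb R^p$. Write $S_i=\sum_t Y_{it}$, and $(X,Y,S)$ for a generic $(X_i,Y_i,S_i)$. Assume that the support of $X$ is compact and that $E\big[\sum_{t,t'}(X_t-X_{t'})(X_t-X_{t'})'\big]$ is nonsingular. **Conditional likelihood.** For $y\in\{0,1\}^T$, $s=\sum_t y_t$, let $$C_s(x,\beta)=\sum_{d\in\{0,1\}^T:\,\sum_t d_t=s}\exp\Big(\sum_t d_t x_t'\beta\Big),\qquad \ell_c(y|x;\beta)=\sum_t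 y_t x_t'\beta-\ln C_s(x,\beta).$$ Let $\Theta\subseteq\mathbb R^p$ have $\beta_0$ in its interior ($\Theta=\mathbb R^p$ is allowed), and let $\widehat\beta$ be the conditional maximum likelihood estimator: a random vector that maximizes $\sum_{i=1}^n\ell_c(Y_i|X_i;\beta)$ over $\beta\in\Theta$ whenever a maximizer exists (otherwise it is arbitrary). Let $$\mathcal I_0=-E\Big[\frac{\partial^2\ell_c}{\partial\beta\partial\beta'}(Y|X;\beta_0)\Big],\quad \phi_i=\mathcal I_0^{-1}\frac{\partial\ell_c}{\partial\beta}(Y_i|X_i;\beta_0),\quad \widehat\phi_i=\Big[-\frac1n\sum_{j=1}^n\frac{\partial^2\ell_c}{\partial\beta\partial\beta'}(Y_j|X_j;\widehat\beta)\Big]^{-1}\frac{\partial\ell_c}{\partial\beta}(Y_i|X_i;\widehat\beta).$$ **Target and estimator.** Let $\lambda_0(x,\beta),\dots,\lambda_{T+1}(x,\beta)$ be the coefficients in $u$ of $u(1-u)\prod_{t=1}^{T-1}\big(u(e^{(x_t-x_T)'\beta}-1)+1\big)$. Let $\mathbb T_{T+1}$ be the monic Chebyshev polynomial of degree $T+1$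 on $[0,1]$, that is $\mathbb T_{T+1}(u)=2^{-2T-1}\cos\big((T+1)\arccos(2u-1)\big)$ on $[0,1]$, let $P^*_T(u)=u^{T+1}-\mathbb T_{T+1}(u)$, and let $b_t$ be the coefficient of $u^t$ in $P^*_T$. For $0\le t\le s\le T$ put $w_{t,s}(x,\beta)=\binom{T-t}{s-t}\exp(s\,x_T'\beta)/C_s(x,\beta)$, and let $$r(x,s,\beta)=\beta_k\sum_{t=0}^s\lambda_t(x,\beta)w_{t,s}(x,\beta),\qquad p(x,s,\beta)=\sum_{t=0}^s\big(\lambda_t(x,\beta)+b_t\lambda_{T+1}(x,\beta)\big)w_{t,s}(x,\beta),$$ $$c_t(x)=E\big[\mathbf 1\{S\ge t\}w_{t,S}(x,\beta_0)\,\big|\,X=x\big],\qquad \tilde\Delta=E\Big[r(X,S,\beta_0)+\beta_{0k}\lambda_{T+1}(X,\beta_0)\sum_{t=0}^T b_tc_t(X)\Big],\qquad \widehat\Delta=\frac{\widehat\beta_k}{n}\sum_{i=1}^n p(X_i,S_i,\widehat\beta).$$ Let $$\psi_i=E[p(X,S,\beta_0)]\,\phi_{ik}+\beta_{0k}\Big\{p(X_i,S_i,\beta_0)-E[p(X,S,\beta_0)]+E\Big[\frac{\partial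 p}{\partial\beta}(X,S,\beta_0)\Big]'\phi_i\Big\},\qquad \sigma^2=V(\psi_i),$$ $$\widehat\psi_i=\bar p\,\widehat\phi_{ik}+\widehat\beta_k\Big\{p(X_i,S_i,\widehat\beta)-\bar p+\Big(\frac1n\sum_{j=1}^n\frac{\partial p}{\partial\beta}(X_j,S_j,\widehat\beta)\Big)'\widehat\phi_i\Big\},\quad \bar p=\frac1n\sum_{j=1}^n p(X_j,S_j,\widehat\beta),\qquad \widehat\sigma^2=\frac1n\sum_{i=1}^n\widehat\psi_i^2.$$ **Claim.** The matrix $\mathcal I_0$ is nonsingular and $\psi_i$ is square integrable. Moreover $\tilde\Delta=\beta_{0k}E[p(X,S,\beta_0)]$, and, for every collection $(\mu_x)$ of probability measures on $[0,1]$ such that almost surely $\int u^t\,d\mu_X(u)=c_t(X)/c_0(X)$ for $t=0,\dots,T$, $\tilde\Delta=E\big[r(X,S,\beta_0)+\beta_{0k}c_0(X)\lambda_{T+1}(X,\beta_0)\int P^*_T\,d\mu_X\big]$. As $n\to\infty$, $$\sqrt n\,(\widehat\Delta-\tilde\Delta)=\frac1{\sqrt n}\sum_{i=1}^n\psi_i+o_P(1)\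 \xrightarrow{d}\ \mathcal N(0,\sigma^2),\qquad \widehat\sigma\ \xrightarrow{P}\ \sigma,$$ where $\mathcal N(0,0)$ is the point mass at $0$. -/

import Mathlib

open MeasureTheory ProbabilityTheory Filter Topology

namespace FELogit

noncomputable section

/-! ### The fixed effects logit model

There are `T` periods, indexed by `Fin T`, and `p` covariates, indexed by `Fin p`. -/

/-- A value `x = (x_1, ..., x_T)` of the covariates; `x t` is the vector `x_t` in `ℝ^p`. -/
abbrev Covariates (T p : ℕ) : Type := Fin T → Fin p → ℝ

/-- A vector of binary outcomes, an element of `{0,1}^T`. -/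
abbrev Outcomes (T : ℕ) : Type := Fin T → Fin 2

/-- The last period. -/
def lastPeriod (T : ℕ) [NeZero T] : Fin T := ⟨T - 1, Nat.sub_lt (NeZero.pos T) Nat.one_pos⟩

/-- `S = ∑_t y_t`. -/
def numOnes {T : ℕ} (y : Outcomes T) : ℕ := ∑ t, (y t : ℕ)

/-- An i.i.d. sample (indexed by `i : ℕ`) of the fixed effects logit model with slope parameter
`β₀`: covariates `X i`, individual effects `α i`, errors `ε i`, and outcomes `Y i`, on the
probability space `(Ω, P)`. -/
structure IsSample {Ω : Type*} [MeasurableSpace Ω] (P : Measure Ω) {T p : ℕ}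
    (X : ℕ → Ω → Covariates T p) (α : ℕ → Ω → ℝ) (ε : ℕ → Ω → Fin T → ℝ)
    (Y : ℕ → Ω → Outcomes T) (β₀ : Fin p → ℝ) : Prop where
  measurable_X : ∀ i, Measurable (X i)
  measurable_α : ∀ i, Measurable (α i)
  measurable_ε : ∀ i, Measurable (ε i)
  /-- `(X_i, α_i, ε_i)` are independent across `i`. -/
  indep : iIndepFun (fun i ω => (X i ω, α i ω, ε i ω)) P
  /-- `(X_i, α_i, ε_i)` are identically distributed across `i`. -/
  ident : ∀ i, IdentDistrib (fun ω => (X i ω, α i ω, ε i ω)) (fun ω => (X 0 ω, α 0 ω, ε 0 ω)) P P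
  /-- The errors are independent across periods. -/
  indep_ε : ∀ i, iIndepFun (fun t ω => ε i ω t) P
  /-- The errors follow the (standard) logistic distribution, with cdf `1 / (1 + exp (-z))`. -/
  logistic_ε : ∀ i t z, P.real {ω | ε i ω t ≤ z} = 1 / (1 + Real.exp (-z))
  /-- The errors are independent of `(α, X)`, whose joint distribution is unrestricted. -/
  indep_ε_αX : ∀ i, IndepFun (ε i) (fun ω => (α i ω, X i ω)) P
  /-- `Y_t = 1{X_t'β₀ + α + ε_t ≥ 0}`. -/
  outcome : ∀ i ω t, Y i ω t = if 0 ≤ X i ω t ⬝ᵥ β₀ + α i ω + ε i ω t then 1 else 0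

/-- The matrix `E[∑_{t,t'} (X_t - X_{t'}) (X_t - X_{t'})']`. -/
def variationMatrix {Ω : Type*} [MeasurableSpace Ω] (P : Measure Ω) {T p : ℕ}
    (X : Ω → Covariates T p) : Matrix (Fin p) (Fin p) ℝ :=
  Matrix.of fun j l => ∫ ω, ∑ t, ∑ t', (X ω t j - X ω t' j) * (X ω t l - X ω t' l) ∂P

/-! ### Conditional likelihood -/

/-- `C_k(x, β) = ∑_{d ∈ {0,1}^T, ∑ d_t = k} exp(∑_t d_t x_t'β)`. -/
def condC {T p : ℕ} (k : ℕ) (x : Covariates T p) (β : Fin p → ℝ) : ℝ :=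
  ∑ d : Outcomes T with numOnes d = k, Real.exp (∑ t, ((d t : ℕ) : ℝ) * (x t ⬝ᵥ β))

/-- The conditional log-likelihood `ℓ_c(y | x; β)`. -/
def condLogLik {T p : ℕ} (y : Outcomes T) (x : Covariates T p) (β : Fin p → ℝ) : ℝ :=
  ∑ t, ((y t : ℕ) : ℝ) * (x t ⬝ᵥ β) - Real.log (condC (numOnes y) x β)

/-- The vector of partial derivatives of `f` at `β`. -/
def grad {p : ℕ} (f : (Fin p → ℝ) → ℝ) (β : Fin p → ℝ) : Fin p → ℝ :=
  fun j => fderiv ℝ f β (Pi.single j 1)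

/-- The matrix of second-order partial derivatives of `f` at `β`. -/
def hess {p : ℕ} (f : (Fin p → ℝ) → ℝ) (β : Fin p → ℝ) : Matrix (Fin p) (Fin p) ℝ :=
  Matrix.of fun j l => grad (fun b => grad f b j) β l

/-- `β̂` is a conditional maximum likelihood estimator over the parameter set `Θ`: for every sample
size `n`, `β̂ n` is a random vector that maximizes over `Θ` the conditional log-likelihood of the
first `n` observations whenever a maximizer exists (when there is none, `β̂ n` is arbitrary). -/
def IsCMLE {Ω : Type*} [MeasurableSpace Ω] (P : Measure Ω) {T p : ℕ}
    (X : ℕ → Ω → Covariates T p) (Y : ℕ → Ω → Outcomes T) (Θ : Set (Fin p → ℝ))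
    (βhat : ℕ → Ω → Fin p → ℝ) : Prop :=
  ∀ n, AEMeasurable (βhat n) P ∧ ∀ᵐ ω ∂P,
    (∃ b ∈ Θ, IsMaxOn (fun β => ∑ i ∈ Finset.range n, condLogLik (Y i ω) (X i ω) β) Θ b) →
      βhat n ω ∈ Θ ∧
        IsMaxOn (fun β => ∑ i ∈ Finset.range n, condLogLik (Y i ω) (X i ω) β) Θ (βhat n ω)

/-- `𝓘₀ = -E[∂²ℓ_c/∂β∂β' (Y | X; β₀)]`. -/
def information {Ω : Type*} [MeasurableSpace Ω] (P : Measure Ω) {T p : ℕ}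
    (X : Ω → Covariates T p) (Y : Ω → Outcomes T) (β₀ : Fin p → ℝ) : Matrix (Fin p) (Fin p) ℝ :=
  Matrix.of fun j l => -∫ ω, hess (condLogLik (Y ω) (X ω)) β₀ j l ∂P

/-- `φ_i = 𝓘₀⁻¹ ∂ℓ_c/∂β (Y_i | X_i; β₀)`. -/
def phi {Ω : Type*} [MeasurableSpace Ω] (P : Measure Ω) {T p : ℕ}
    (X : ℕ → Ω → Covariates T p) (Y : ℕ → Ω → Outcomes T) (β₀ : Fin p → ℝ) (i : ℕ) (ω : Ω) :
    Fin p → ℝ :=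
  (information P (X 0) (Y 0) β₀)⁻¹.mulVec (grad (condLogLik (Y i ω) (X i ω)) β₀)

/-- The plug-in estimator of `𝓘₀`. -/
def informationHat {Ω : Type*} {T p : ℕ} (X : ℕ → Ω → Covariates T p) (Y : ℕ → Ω → Outcomes T)
    (βhat : ℕ → Ω → Fin p → ℝ) (n : ℕ) (ω : Ω) : Matrix (Fin p) (Fin p) ℝ :=
  Matrix.of fun j l =>
    -((1 / (n : ℝ)) * ∑ i ∈ Finset.range n, hess (condLogLik (Y i ω) (X i ω)) (βhat n ω) j l)

/-- The plug-in estimator `φ̂_i` of `φ_i`, for the sample size `n`. -/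
def phiHat {Ω : Type*} {T p : ℕ} (X : ℕ → Ω → Covariates T p) (Y : ℕ → Ω → Outcomes T)
    (βhat : ℕ → Ω → Fin p → ℝ) (n i : ℕ) (ω : Ω) : Fin p → ℝ :=
  (informationHat X Y βhat n ω)⁻¹.mulVec (grad (condLogLik (Y i ω) (X i ω)) (βhat n ω))

/-! ### The approximation `Δ̃` of the average marginal effect -/

/-- The polynomial `u (1 - u) ∏_{t=1}^{T-1} (u (exp((x_t - x_T)'β) - 1) + 1)` in `u`. -/
def lambdaPoly {T p : ℕ} [NeZero T] (x : Covariates T p) (β : Fin p → ℝ) : Polynomial ℝ :=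
  Polynomial.X * (1 - Polynomial.X) *
    ∏ t ∈ Finset.univ.erase (lastPeriod T),
      (Polynomial.X * Polynomial.C (Real.exp ((x t - x (lastPeriod T)) ⬝ᵥ β) - 1) + 1)

/-- `λ_t(x, β)`, the coefficient of `u^t` in `lambdaPoly x β`. -/
def lam {T p : ℕ} [NeZero T] (t : ℕ) (x : Covariates T p) (β : Fin p → ℝ) : ℝ :=
  (lambdaPoly x β).coeff t

/-- The monic Chebyshev polynomial of degree `m` on `[-1, 1]`, for `m ≥ 1`. -/
def monicChebyshev (m : ℕ) : Polynomial ℝ :=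
  Polynomial.C ((2 ^ (m - 1) : ℝ)⁻¹) * Polynomial.Chebyshev.T ℝ (m : ℤ)

/-- `𝕋_{T+1}(u) = 2^{-T-1} 𝕋^c_{T+1}(2u - 1)`, the monic Chebyshev polynomial of degree `T + 1`
on `[0, 1]`. -/
def shiftedChebyshev (T : ℕ) : Polynomial ℝ :=
  Polynomial.C ((2 ^ (T + 1) : ℝ)⁻¹) *
    (monicChebyshev (T + 1)).comp (2 * Polynomial.X - 1)

/-- `P*_T(u) = u^{T+1} - 𝕋_{T+1}(u)`, the best uniform approximation of `u^{T+1}` on `[0, 1]` by a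
polynomial of degree at most `T`. -/
def bestApprox (T : ℕ) : Polynomial ℝ := Polynomial.X ^ (T + 1) - shiftedChebyshev T

/-- `binom(T-t, s-t) exp(s x_T'β) / C_s(x, β)`, where `t ≤ s ≤ T`. -/
def weight {T p : ℕ} [NeZero T] (t s : ℕ) (x : Covariates T p) (β : Fin p → ℝ) : ℝ :=
  ((T - t).choose (s - t) : ℝ) * Real.exp ((s : ℝ) * (x (lastPeriod T) ⬝ᵥ β)) / condC s x β

/-- `r(x, s, β) = β_k ∑_{t=0}^s binom(T-t, s-t) λ_t(x, β) exp(s x_T'β) / C_s(x, β)`. -/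
def rFun {T p : ℕ} [NeZero T] (k : Fin p) (x : Covariates T p) (s : ℕ) (β : Fin p → ℝ) : ℝ :=
  β k * ∑ t ∈ Finset.range (s + 1), lam t x β * weight t s x β

/-- `p(x, s, β) = ∑_{t=0}^s binom(T-t, s-t) (λ_t(x, β) + b_t λ_{T+1}(x, β)) exp(s x_T'β) / C_s(x, β)`,
where `b_t` is the coefficient of `u^t` in `P*_T`. -/
def pFun {T p : ℕ} [NeZero T] (x : Covariates T p) (s : ℕ) (β : Fin p → ℝ) : ℝ :=
  ∑ t ∈ Finset.range (s + 1),
    (lam t x β + (bestApprox T).coeff t * lam (T + 1) x β) * weight t s x β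

/-- The random variable `c_t(X)`, where
`c_t(x) = E[1{S ≥ t} binom(T-t, S-t) exp(S x_T'β₀) / C_S(x, β₀) | X = x]`. -/
def cX {Ω : Type*} [MeasurableSpace Ω] (P : Measure Ω) {T p : ℕ} [NeZero T]
    (X : Ω → Covariates T p) (Y : Ω → Outcomes T) (β₀ : Fin p → ℝ) (t : ℕ) : Ω → ℝ :=
  P[fun ω => if t ≤ numOnes (Y ω) then weight t (numOnes (Y ω)) (X ω) β₀ else 0 |
    MeasurableSpace.comap X inferInstance]

/-- `Δ̃ = E[r(X, S, β₀) + β₀ₖ λ_{T+1}(X, β₀) ∑_{t=0}^T b_t c_t(X)]`. -/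
def deltaTilde {Ω : Type*} [MeasurableSpace Ω] (P : Measure Ω) {T p : ℕ} [NeZero T]
    (X : Ω → Covariates T p) (Y : Ω → Outcomes T) (β₀ : Fin p → ℝ) (k : Fin p) : ℝ :=
  ∫ ω, (rFun k (X ω) (numOnes (Y ω)) β₀ + β₀ k * lam (T + 1) (X ω) β₀ *
    ∑ t ∈ Finset.range (T + 1), (bestApprox T).coeff t * cX P X Y β₀ t ω) ∂P

/-- `(μ_x)` is a collection of probability measures on `[0, 1]` such that, almost surely, the first
moments of `μ_X` are `m_t(X) = c_t(X) / c_0(X)`, `t = 0, ..., T`. -/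
def IsMomentFamily {Ω : Type*} [MeasurableSpace Ω] (P : Measure Ω) {T p : ℕ} [NeZero T]
    (X : Ω → Covariates T p) (Y : Ω → Outcomes T) (β₀ : Fin p → ℝ)
    (μ : Covariates T p → Measure ℝ) : Prop :=
  ∀ᵐ ω ∂P, IsProbabilityMeasure (μ (X ω)) ∧ μ (X ω) (Set.Icc 0 1)ᶜ = 0 ∧
    ∀ t ≤ T, ∫ u, u ^ t ∂(μ (X ω)) = cX P X Y β₀ t ω / cX P X Y β₀ 0 ω

/-! ### The estimator, its influence function and its variance -/

/-- `n⁻¹ ∑_{i ≤ n} p(X_i, S_i, β̂)`. -/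
def pMean {Ω : Type*} {T p : ℕ} [NeZero T] (X : ℕ → Ω → Covariates T p)
    (Y : ℕ → Ω → Outcomes T) (βhat : ℕ → Ω → Fin p → ℝ) (n : ℕ) (ω : Ω) : ℝ :=
  (1 / (n : ℝ)) * ∑ i ∈ Finset.range n, pFun (X i ω) (numOnes (Y i ω)) (βhat n ω)

/-- `n⁻¹ ∑_{i ≤ n} ∂p/∂β (X_i, S_i, β̂)`. -/
def pGradMean {Ω : Type*} {T p : ℕ} [NeZero T] (X : ℕ → Ω → Covariates T p)
    (Y : ℕ → Ω → Outcomes T) (βhat : ℕ → Ω → Fin p → ℝ) (n : ℕ) (ω : Ω) : Fin p → ℝ :=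
  fun j => (1 / (n : ℝ)) *
    ∑ i ∈ Finset.range n, grad (pFun (X i ω) (numOnes (Y i ω))) (βhat n ω) j

/-- The plug-in estimator `Δ̂ = β̂ₖ n⁻¹ ∑_{i ≤ n} p(X_i, S_i, β̂)`. -/
def deltaHat {Ω : Type*} {T p : ℕ} [NeZero T] (X : ℕ → Ω → Covariates T p)
    (Y : ℕ → Ω → Outcomes T) (βhat : ℕ → Ω → Fin p → ℝ) (k : Fin p) (n : ℕ) (ω : Ω) : ℝ :=
  βhat n ω k * pMean X Y βhat n ω

/-- `ψ_i = E[p(X,S,β₀)] φ_{ik}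
  + β₀ₖ {p(X_i,S_i,β₀) - E[p(X,S,β₀)] + E[∂p/∂β(X,S,β₀)]' φ_i}`. -/
def psi {Ω : Type*} [MeasurableSpace Ω] (P : Measure Ω) {T p : ℕ} [NeZero T]
    (X : ℕ → Ω → Covariates T p) (Y : ℕ → Ω → Outcomes T) (β₀ : Fin p → ℝ) (k : Fin p)
    (i : ℕ) (ω : Ω) : ℝ :=
  (∫ ω', pFun (X 0 ω') (numOnes (Y 0 ω')) β₀ ∂P) * phi P X Y β₀ i ω k +
    β₀ k * (pFun (X i ω) (numOnes (Y i ω)) β₀ - (∫ ω', pFun (X 0 ω') (numOnes (Y 0 ω')) β₀ ∂P) +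
      (fun j => ∫ ω', grad (pFun (X 0 ω') (numOnes (Y 0 ω'))) β₀ j ∂P) ⬝ᵥ phi P X Y β₀ i ω)

/-- The plug-in estimator `ψ̂_i` of `ψ_i`, for the sample size `n`. -/
def psiHat {Ω : Type*} {T p : ℕ} [NeZero T] (X : ℕ → Ω → Covariates T p)
    (Y : ℕ → Ω → Outcomes T) (βhat : ℕ → Ω → Fin p → ℝ) (k : Fin p) (n i : ℕ) (ω : Ω) : ℝ :=
  pMean X Y βhat n ω * phiHat X Y βhat n i ω k +
    βhat n ω k * (pFun (X i ω) (numOnes (Y i ω)) (βhat n ω) - pMean X Y βhat n ω +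
      pGradMean X Y βhat n ω ⬝ᵥ phiHat X Y βhat n i ω)

/-- `σ̂ = (n⁻¹ ∑_{i ≤ n} ψ̂_i²)^{1/2}`. -/
def sigmaHat {Ω : Type*} {T p : ℕ} [NeZero T] (X : ℕ → Ω → Covariates T p)
    (Y : ℕ → Ω → Outcomes T) (βhat : ℕ → Ω → Fin p → ℝ) (k : Fin p) (n : ℕ) (ω : Ω) : ℝ :=
  Real.sqrt ((1 / (n : ℝ)) * ∑ i ∈ Finset.range n, psiHat X Y βhat k n i ω ^ 2)

end

end FELogit

/-! Given the covariates `x` and the effect `a`, logistic errors make the probability of an outcome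
vector `y` factor as `exp (condLogLik y x β₀)` times a positive term depending on `y` only through
its number of ones. Conditioning on `S` therefore removes the individual effect, whatever its law,
and leaves on each slice `{d | numOnes d = s}` an exponential family in `β`. There the score is a
centered sufficient statistic, minus the Hessian is a covariance, and the log-likelihood gap is
minus a Kullback-Leibler divergence.

Every outcome has positive probability, so a nonnegative function of the observation with mean zero
vanishes at all outcomes. Applied on the slice of outcomes with a single one, this shows that a
second maximizer of the mean likelihood, or a kernel vector of the information matrix, yields a
vector orthogonal to all differences `X_t - X_{t'}`. Nonsingularity of the variation matrix excludes
it.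

For the asymptotics, compact support and joint smoothness give a uniform strong law from the
Banach-valued law in `C(B, ℝ)`. Concavity upgrades it to strong consistency without compactness of
`Θ`, and the first order condition eventually holds. Hadamard's lemma writes this condition and the
increment of `p` as exact linear equations in `β̂ - β₀`, whose coefficients are sample means of
continuous slopes. After inversion, the linearization error is `∑ j, c_n j * Z_n j`, with `c_n j →
0` almost surely and normalized scores `Z_n j` bounded in `L²`. It is thus `o_P(1)` with no separate
rate for `β̂`. The central limit theorem and Slutsky's lemma give normality. The variance estimator
is a sample mean of squares of one continuous function at consistent arguments.

For `Δ̃`, pulling out functions of `X` and the tower property replace `c_t(X)` by the underlying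
weights. The moment form holds because `P*_T` has degree at most `T`, so its integral uses only the
matched moments. -/

namespace FELogit

/-! ### Uniform laws of large numbers -/

/-- An i.i.d. sequence whose terms almost surely belong to a compact set `K`. -/
structure IsCompactIID {Ω 𝒲 : Type*} [MeasurableSpace Ω] [TopologicalSpace 𝒲] [MeasurableSpace 𝒲]
    (P : Measure Ω) (W : ℕ → Ω → 𝒲) (K : Set 𝒲) : Prop where
  measurable : ∀ i, Measurable (W i)
  indep : iIndepFun W P
  ident : ∀ i, IdentDistrib (W i) (W 0) P P
  compact : IsCompact K
  mem : ∀ᵐ ω ∂P, W 0 ω ∈ K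

section LLN

variable {Ω 𝒲 E : Type*} [MeasurableSpace Ω] {P : Measure Ω} [IsProbabilityMeasure P]
  [TopologicalSpace 𝒲] [MeasurableSpace 𝒲] [BorelSpace 𝒲]
  {W : ℕ → Ω → 𝒲} {K : Set 𝒲}

theorem IsCompactIID.integrable_comp (hW : IsCompactIID P W K) {F : Type*} [NormedAddCommGroup F]
    [SecondCountableTopology F]
    {g : 𝒲 → F} (hg : Continuous g) : Integrable (fun ω => g (W 0 ω)) P := by
  obtain ⟨C, hC⟩ := (hW.compact.image hg).isBounded.exists_norm_le
  borelize F
  refine Integrable.of_bound ((hg.measurable.comp (hW.measurable 0)).aestronglyMeasurable) C ?_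
  filter_upwards [hW.mem] with ω hω
  exact hC _ ⟨_, hω, rfl⟩

theorem IsCompactIID.memLp_comp (hW : IsCompactIID P W K)
    {g : 𝒲 → ℝ} (hg : Continuous g) (q : ENNReal) : MemLp (fun ω => g (W 0 ω)) q P := by
  obtain ⟨C, hC⟩ := (hW.compact.image hg).isBounded.exists_norm_le
  refine MemLp.of_bound ((hg.measurable.comp (hW.measurable 0)).aestronglyMeasurable) C ?_
  filter_upwards [hW.mem] with ω hω
  exact hC _ ⟨_, hω, rfl⟩

/-- The uniform strong law of large numbers over a compact parameter set: the sample means, as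
elements of `C(B, ℝ)`, converge almost surely to the mean. -/
theorem IsCompactIID.exists_uniform_lln (hW : IsCompactIID P W K) [MetricSpace E]
    {B : Set E} (hB : IsCompact B) {g : 𝒲 → E → ℝ} (hg : Continuous (Function.uncurry g)) :
    ∃ m : C(B, ℝ), (∀ b : B, m b = ∫ ω, g (W 0 ω) b ∂P) ∧
      ∀ᵐ ω ∂P, ∃ M : ℕ → C(B, ℝ),
        (∀ n b, M n b = (1 / (n : ℝ)) * ∑ i ∈ Finset.range n, g (W i ω) b) ∧
          Tendsto M atTop (𝓝 m) := by
  have : CompactSpace B := isCompact_iff_compactSpace.1 hB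
  let _ : MeasurableSpace C(B, ℝ) := borel _
  have : BorelSpace C(B, ℝ) := ⟨rfl⟩
  -- Currying makes a continuous map into `C(B, ℝ)`, a separable Banach space because `B` is compact
  -- metric. The strong law in that space is already uniform in the parameter.
  let G₀ : C(𝒲 × B, ℝ) := ⟨fun z => g z.1 z.2, by
    exact hg.comp (continuous_fst.prodMk (continuous_subtype_val.comp continuous_snd))⟩
  let G : C(𝒲, C(B, ℝ)) := G₀.curry
  have hGm : Measurable G := G.continuous.measurable
  have hint : Integrable (fun ω => G (W 0 ω)) P := hW.integrable_comp G.continuous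
  have hlln := strong_law_ae (μ := P) (fun i ω => G (W i ω)) hint
    (fun i j hij => (hW.indep.indepFun hij).comp hGm hGm)
    (fun i => (hW.ident i).comp hGm)
  refine ⟨∫ ω, G (W 0 ω) ∂P, fun b => ?_, ?_⟩
  · have := (ContinuousMap.evalCLM ℝ b : C(B, ℝ) →L[ℝ] ℝ).integral_comp_comm hint
    exact this.symm
  · filter_upwards [hlln] with ω hω
    refine ⟨_, fun n b => ?_, hω⟩
    have hG : ∀ i, G (W i ω) b = g (W i ω) b := fun i => rfl
    simp [hG]

/-- Sample means of a continuous function at a strongly consistent estimator converge almost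
surely. -/
theorem IsCompactIID.tendsto_mean_comp (hW : IsCompactIID P W K) [MetricSpace E]
    [LocallyCompactSpace E] {g : 𝒲 → E → ℝ} (hg : Continuous (Function.uncurry g))
    {θ : ℕ → Ω → E} {θ₀ : E} (hθ : ∀ᵐ ω ∂P, Tendsto (fun n => θ n ω) atTop (𝓝 θ₀)) :
    ∀ᵐ ω ∂P, Tendsto (fun n : ℕ => (1 / (n : ℝ)) * ∑ i ∈ Finset.range n, g (W i ω) (θ n ω)) atTop
      (𝓝 (∫ ω, g (W 0 ω) θ₀ ∂P)) := by
  obtain ⟨B, hB, hBθ⟩ := exists_compact_mem_nhds θ₀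
  obtain ⟨m, hm, hM⟩ := hW.exists_uniform_lln hB hg
  have : CompactSpace B := isCompact_iff_compactSpace.1 hB
  filter_upwards [hM, hθ] with ω ⟨M, hMe, hMt⟩ hω
  have hev : ∀ᶠ n in atTop, θ n ω ∈ B := hω.eventually hBθ
  classical
  let b₀ : B := ⟨θ₀, mem_of_mem_nhds hBθ⟩
  -- The default `b₀` is used for finitely many `n` only, since the estimator eventually lies in
  -- `B`.
  let b : ℕ → B := fun n => if h : θ n ω ∈ B then ⟨θ n ω, h⟩ else b₀
  have hb : Tendsto b atTop (𝓝 b₀) := by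
    rw [tendsto_subtype_rng]
    refine hω.congr' ?_
    filter_upwards [hev] with n hn
    simp [b, hn]
  have h1 : Tendsto (fun n => M n (b n)) atTop (𝓝 (m b₀)) :=
    (continuous_eval.tendsto (m, b₀)).comp (hMt.prodMk_nhds hb)
  rw [hm] at h1
  refine h1.congr' ?_
  filter_upwards [hev] with n hn
  rw [hMe]
  simp [b, hn]

/-! ### Strong consistency of concave M-estimators -/

/-- The maximizers of sample means of concave functions are strongly consistent, whatever the
parameter set, if the limit is uniquely maximized at an interior point. -/
theorem IsCompactIID.tendsto_argmax (hW : IsCompactIID P W K) [NormedAddCommGroup E]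
    [NormedSpace ℝ E] [ProperSpace E] {f : 𝒲 → E → ℝ} (hf : Continuous (Function.uncurry f))
    (hconc : ∀ w, ConcaveOn ℝ Set.univ (f w)) {θ₀ : E}
    (hmax : ∀ b ≠ θ₀, ∫ ω, f (W 0 ω) b ∂P < ∫ ω, f (W 0 ω) θ₀ ∂P)
    {Θ : Set E} (hΘ : θ₀ ∈ interior Θ) {θ : ℕ → Ω → E}
    (hθ : ∀ n, ∀ᵐ ω ∂P, (∃ b ∈ Θ, IsMaxOn (fun b => ∑ i ∈ Finset.range n, f (W i ω) b) Θ b) →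
      θ n ω ∈ Θ ∧ IsMaxOn (fun b => ∑ i ∈ Finset.range n, f (W i ω) b) Θ (θ n ω)) :
    ∀ᵐ ω ∂P, Tendsto (fun n => θ n ω) atTop (𝓝 θ₀) ∧
      ∀ᶠ n in atTop, IsMaxOn (fun b => ∑ i ∈ Finset.range n, f (W i ω) b) Θ (θ n ω) := by
  obtain ⟨r, hr, hrΘ⟩ : ∃ r > 0, Metric.closedBall θ₀ r ⊆ Θ :=
    Metric.nhds_basis_closedBall.mem_iff.1 (mem_interior_iff_mem_nhds.1 hΘ)
  have key : ∀ δ : ℝ, 0 < δ → δ ≤ r → ∀ᵐ ω ∂P, ∀ᶠ n : ℕ in atTop,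
      ∀ b, δ < dist b θ₀ → ∑ i ∈ Finset.range n, f (W i ω) b <
        ∑ i ∈ Finset.range n, f (W i ω) θ₀ := by
    intro δ hδ _
    have hB := isCompact_closedBall θ₀ δ
    obtain ⟨m, hm, hM⟩ := hW.exists_uniform_lln hB hf
    have : CompactSpace (Metric.closedBall θ₀ δ) := isCompact_iff_compactSpace.1 hB
    let b₀ : Metric.closedBall θ₀ δ := ⟨θ₀, Metric.mem_closedBall_self hδ.le⟩
    let S : Set (Metric.closedBall θ₀ δ) := {b | dist (b : E) θ₀ = δ}
    have hS : IsCompact S := by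
      refine IsClosed.isCompact ?_
      exact isClosed_eq (by fun_prop) continuous_const
    -- The unique maximizer leaves a positive gap on the compact sphere of radius `δ`. The sphere
    -- may be empty, as in dimension zero; any gap then works.
    obtain ⟨η, hη, hgap⟩ : ∃ η > 0, ∀ b ∈ S, m b + η ≤ m b₀ := by
      rcases S.eq_empty_or_nonempty with h | h
      · exact ⟨1, one_pos, by simp [h]⟩
      · obtain ⟨c, hc, hcm⟩ := hS.exists_isMaxOn h m.continuous.continuousOn
        refine ⟨m b₀ - m c, ?_, fun b hb => ?_⟩
        · have hne : (c : E) ≠ θ₀ := by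
            intro h0
            have : dist (c : E) θ₀ = δ := hc
            rw [h0, dist_self] at this
            exact hδ.ne this
          have := hmax c hne
          rw [hm, hm]
          exact sub_pos.2 this
        · have : m b ≤ m c := hcm hb
          linarith
    filter_upwards [hM] with ω ⟨M, hMe, hMt⟩
    have hclose : ∀ᶠ n in atTop, dist (M n) m < η / 2 :=
      hMt.eventually (Metric.ball_mem_nhds _ (half_pos hη))
    filter_upwards [hclose, eventually_gt_atTop 0] with n hn hn0 b hb
    by_contra! hcon
    have hn0' : (0 : ℝ) < n := by exact_mod_cast hn0
    have hd : 0 < dist b θ₀ := hδ.trans hb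
    -- the point of the segment at distance `δ`
    set t : ℝ := δ / dist b θ₀ with ht
    have ht0 : 0 < t := div_pos hδ hd
    have ht1 : t < 1 := (div_lt_one hd).2 hb
    set c : E := (1 - t) • θ₀ + t • b with hc
    have hcd : dist c θ₀ = δ := by
      have : c - θ₀ = t • (b - θ₀) := by rw [hc]; module
      rw [dist_eq_norm, this, norm_smul, Real.norm_of_nonneg ht0.le, ← dist_eq_norm, ht]
      field_simp
    -- A far point at least as good as `θ₀` forces, by concavity, a point of the sphere at least as
    -- good as `θ₀`. Uniform convergence within `η / 2` forbids this.
    have hconcc : ∑ i ∈ Finset.range n, f (W i ω) θ₀ ≤ ∑ i ∈ Finset.range n, f (W i ω) c := by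
      have h2 : (1 - t) * ∑ i ∈ Finset.range n, f (W i ω) θ₀ +
          t * ∑ i ∈ Finset.range n, f (W i ω) b ≤ ∑ i ∈ Finset.range n, f (W i ω) c := by
        rw [Finset.mul_sum, Finset.mul_sum, ← Finset.sum_add_distrib]
        refine Finset.sum_le_sum fun i _ => ?_
        have := (hconc (W i ω)).2 (Set.mem_univ θ₀) (Set.mem_univ b)
          (sub_nonneg.2 ht1.le) ht0.le (by ring)
        simpa using this
      nlinarith
    let c' : Metric.closedBall θ₀ δ := ⟨c, hcd.le⟩
    have h3 : M n b₀ ≤ M n c' := by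
      rw [hMe, hMe]
      exact mul_le_mul_of_nonneg_left hconcc (by positivity)
    have h4 : dist (M n b₀) (m b₀) < η / 2 := (ContinuousMap.dist_apply_le_dist _).trans_lt hn
    have h5 : dist (M n c') (m c') < η / 2 := (ContinuousMap.dist_apply_le_dist _).trans_lt hn
    have h6 := hgap c' hcd
    rw [Real.dist_eq, abs_lt] at h4 h5
    linarith [h4.1, h5.2]
  -- Countably many radii suffice for consistency and share a single null set.
  have hall : ∀ᵐ ω ∂P, ∀ j : ℕ, ∀ᶠ n : ℕ in atTop,
      ∀ b, r / (j + 1) < dist b θ₀ → ∑ i ∈ Finset.range n, f (W i ω) b <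
        ∑ i ∈ Finset.range n, f (W i ω) θ₀ := by
    refine ae_all_iff.2 fun j => key _ (by positivity) ?_
    exact div_le_self hr.le (by norm_cast; omega)
  filter_upwards [hall, ae_all_iff.2 hθ] with ω hω hθω
  have hcont : ∀ n, Continuous fun b => ∑ i ∈ Finset.range n, f (W i ω) b := fun n =>
    continuous_finsetSum _ fun i _ => hf.comp (continuous_const.prodMk continuous_id)
  have hex : ∀ᶠ n in atTop, θ n ω ∈ Θ ∧
      IsMaxOn (fun b => ∑ i ∈ Finset.range n, f (W i ω) b) Θ (θ n ω) := by
    -- The index `0` gives the radius `r`: a maximizer over the closed ball inside `Θ` beats every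
    -- point outside it, so a maximizer over `Θ` exists even when `Θ` is not compact.
    filter_upwards [hω 0] with n hn
    refine hθω n ?_
    obtain ⟨c, hc, hcm⟩ := (isCompact_closedBall θ₀ r).exists_isMaxOn
      ⟨θ₀, Metric.mem_closedBall_self hr.le⟩ (hcont n).continuousOn
    refine ⟨c, hrΘ hc, fun b _ => ?_⟩
    by_cases hbr : dist b θ₀ ≤ r
    · exact hcm hbr
    · have h1 := hn b (by simpa using hbr)
      have h2 : ∑ i ∈ Finset.range n, f (W i ω) θ₀ ≤ ∑ i ∈ Finset.range n, f (W i ω) c :=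
        hcm (Metric.mem_closedBall_self hr.le)
      exact h1.le.trans h2
  refine ⟨?_, hex.mono fun n hn => hn.2⟩
  rw [Metric.tendsto_nhds]
  intro e he
  obtain ⟨j, hj⟩ : ∃ j : ℕ, r / (j + 1) < e := by
    obtain ⟨j, hj⟩ := exists_nat_gt (r / e)
    refine ⟨j, (div_lt_iff₀ (by positivity)).2 ?_⟩
    rw [div_lt_iff₀ he] at hj
    nlinarith
  filter_upwards [hω j, hex] with n hn hmx
  by_contra! hcon
  have h1 := hn _ (hj.trans_le hcon)
  have h2 : ∑ i ∈ Finset.range n, f (W i ω) θ₀ ≤ ∑ i ∈ Finset.range n, f (W i ω) (θ n ω) :=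
    hmx.2 (interior_subset hΘ)
  exact absurd h1 (not_lt.2 h2)

end LLN

/-! ### Products of a null sequence and a sequence bounded in `L²` -/

/-- `D = o_P(1)` if `D / (1 + N) → 0` almost surely and `N` is bounded in `L²`. -/
theorem tendstoInMeasure_zero_of_div_tendsto {Ω : Type*} [MeasurableSpace Ω] {P : Measure Ω}
    [IsProbabilityMeasure P] {D N : ℕ → Ω → ℝ} (hD : ∀ n, AEMeasurable (D n) P)
    (hN : ∀ n, AEMeasurable (N n) P) (hN0 : ∀ n ω, 0 ≤ N n ω) {C : ℝ}
    (hint : ∀ n, Integrable (fun ω => N n ω ^ 2) P) (hC : ∀ n, ∫ ω, N n ω ^ 2 ∂P ≤ C)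
    (hlim : ∀ᵐ ω ∂P, Tendsto (fun n => D n ω / (1 + N n ω)) atTop (𝓝 0)) :
    TendstoInMeasure P D atTop (fun _ => 0) := by
  have hr : TendstoInMeasure P (fun n ω => D n ω / (1 + N n ω)) atTop (fun _ => 0) :=
    tendstoInMeasure_of_tendsto_ae
      (fun n => ((hD n).div (aemeasurable_const.add (hN n))).aestronglyMeasurable) hlim
  rw [tendstoInMeasure_iff_measureReal_norm] at hr ⊢
  intro e he
  have hC0 : 0 ≤ C := (integral_nonneg fun ω => sq_nonneg _).trans (hC 0)
  rw [Metric.tendsto_nhds]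
  intro d hd
  obtain ⟨L, hL, hLd⟩ : ∃ L : ℝ, 0 < L ∧ C / L ^ 2 < d / 2 := by
    -- With this `L`, `d / 2 * L ^ 2` expands to `2 * C` plus a nonnegative term plus `d / 2`, hence
    -- exceeds `C`.
    refine ⟨2 * C / d + 1, by positivity, ?_⟩
    rw [div_lt_iff₀ (by positivity)]
    have h1 : d / 2 * (2 * C / d + 1) ^ 2 = C * (2 * C / d) + 2 * C + d / 2 := by
      field_simp; ring
    rw [h1]
    have : 0 ≤ C * (2 * C / d) := by positivity
    linarith
  have h1 := (Metric.tendsto_nhds.1 (hr (e / (1 + L)) (by positivity))) (d / 2) (half_pos hd)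
  filter_upwards [h1] with n hn
  simp only [sub_zero, dist_zero_right, Real.norm_eq_abs, abs_of_nonneg measureReal_nonneg] at hn ⊢
  -- If `N < L`, a large `D` forces a large ratio `D / (1 + N)`. The event `N ≥ L` is left to
  -- Markov's inequality.
  have hsub : {ω | e ≤ |D n ω|} ⊆
      {ω | e / (1 + L) ≤ |D n ω / (1 + N n ω)|} ∪ {ω | L ^ 2 ≤ N n ω ^ 2} := by
    intro ω hω
    simp only [Set.mem_ofPred_eq, Set.mem_union] at hω ⊢
    by_contra! hcon
    have hNL : N n ω < L := lt_of_pow_lt_pow_left₀ 2 hL.le hcon.2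
    have hN' := hN0 n ω
    have h2 := hcon.1
    rw [abs_div, abs_of_pos (by linarith : 0 < 1 + N n ω), div_lt_div_iff₀ (by linarith)
      (by linarith)] at h2
    nlinarith
  have hmarkov : L ^ 2 * P.real {ω | L ^ 2 ≤ N n ω ^ 2} ≤ ∫ ω, N n ω ^ 2 ∂P :=
    mul_meas_ge_le_integral_of_nonneg (ae_of_all _ fun ω => sq_nonneg _) (hint n) _
  have h3 : P.real {ω | L ^ 2 ≤ N n ω ^ 2} ≤ C / L ^ 2 := by
    rw [le_div_iff₀ (by positivity)]
    linarith [hC n]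
  calc P.real {ω | e ≤ |D n ω|} ≤ _ := measureReal_mono hsub
    _ ≤ _ := measureReal_union_le _ _
    _ < d := by linarith

/-- Normalized sums of centered i.i.d. variables are bounded in `L²`. -/
theorem integral_sq_normalized_sum {Ω : Type*} [MeasurableSpace Ω] {P : Measure Ω}
    [IsProbabilityMeasure P] {Z : ℕ → Ω → ℝ} (hindep : iIndepFun Z P)
    (hident : ∀ i, IdentDistrib (Z i) (Z 0) P P) (hZ : MemLp (Z 0) 2 P)
    (h0 : ∫ ω, Z 0 ω ∂P = 0) (n : ℕ) :
    Integrable (fun ω => (1 / √(n : ℝ) * ∑ i ∈ Finset.range n, Z i ω) ^ 2) P ∧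
      ∫ ω, (1 / √(n : ℝ) * ∑ i ∈ Finset.range n, Z i ω) ^ 2 ∂P ≤ ∫ ω, Z 0 ω ^ 2 ∂P := by
  have hZi : ∀ i, MemLp (Z i) 2 P := fun i => (hident i).memLp_iff.2 hZ
  have hsum : MemLp (fun ω => ∑ i ∈ Finset.range n, Z i ω) 2 P := memLp_finsetSum _ fun i _ => hZi i
  have hsm : MemLp (fun ω => 1 / √(n : ℝ) * ∑ i ∈ Finset.range n, Z i ω) 2 P := hsum.const_mul _
  refine ⟨hsm.integrable_sq, ?_⟩
  have hz : ∀ i, ∫ ω, Z i ω ∂P = 0 := fun i => (hident i).integral_eq.trans h0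
  have hv : Var[∑ i ∈ Finset.range n, Z i; P] = n * ∫ ω, Z 0 ω ^ 2 ∂P := by
    rw [IndepFun.variance_sum (fun i _ => hZi i) (fun i _ j _ hij => hindep.indepFun hij)]
    rw [Finset.sum_congr rfl (fun i _ => (hident i).variance_eq),
      variance_of_integral_eq_zero hZ.aemeasurable h0]
    simp
  have hs0 : ∫ ω, (∑ i ∈ Finset.range n, Z i) ω ∂P = 0 := by
    simp only [Finset.sum_apply]
    rw [integral_finsetSum _ fun i _ => (hZi i).integrable (by norm_num)]
    simp [hz]
  have hsae : AEMeasurable (∑ i ∈ Finset.range n, Z i) P := by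
    have := hsum.aemeasurable
    convert this using 1
    ext ω; simp
  rw [variance_of_integral_eq_zero hsae hs0] at hv
  simp only [mul_pow, integral_const_mul]
  simp only [Finset.sum_apply] at hv
  rw [hv, div_pow, Real.sq_sqrt (Nat.cast_nonneg n), one_pow]
  have hI : 0 ≤ ∫ ω, Z 0 ω ^ 2 ∂P := integral_nonneg fun ω => sq_nonneg _
  -- At `n = 0` the normalized sum is zero, so the bound is just nonnegativity.
  rcases eq_or_ne (n : ℝ) 0 with h | h
  · simp [h, hI]
  · rw [← mul_assoc, one_div, inv_mul_cancel₀ h, one_mul]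

section Smoothness

open scoped ContDiff

/-! ### Partial derivatives of jointly smooth functions -/

theorem contDiff_grad {𝒳 : Type*} [NormedAddCommGroup 𝒳] [NormedSpace ℝ 𝒳] {p : ℕ}
    {f : 𝒳 → (Fin p → ℝ) → ℝ} (hf : ContDiff ℝ ∞ (Function.uncurry f)) (j : Fin p) :
    ContDiff ℝ ∞ (Function.uncurry fun x b => grad (f x) b j) := by
  have h1 : ContDiff ℝ ∞ (Function.uncurry fun (z : 𝒳 × (Fin p → ℝ)) b => f z.1 b) :=
    hf.comp ((contDiff_fst.comp contDiff_fst).prodMk contDiff_snd)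
  have h2 : ContDiff ℝ ∞ fun z : 𝒳 × (Fin p → ℝ) => fderiv ℝ (f z.1) z.2 :=
    h1.fderiv contDiff_snd (by simp)
  exact h2.clm_apply contDiff_const

theorem contDiff_of_uncurry {𝒳 : Type*} [NormedAddCommGroup 𝒳] [NormedSpace ℝ 𝒳] {p : ℕ}
    {f : 𝒳 → (Fin p → ℝ) → ℝ} (hf : ContDiff ℝ ∞ (Function.uncurry f)) (x : 𝒳) :
    ContDiff ℝ ∞ (f x) :=
  hf.comp (contDiff_const.prodMk contDiff_id)

theorem contDiff_hess {𝒳 : Type*} [NormedAddCommGroup 𝒳] [NormedSpace ℝ 𝒳] {p : ℕ}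
    {f : 𝒳 → (Fin p → ℝ) → ℝ} (hf : ContDiff ℝ ∞ (Function.uncurry f)) (j l : Fin p) :
    ContDiff ℝ ∞ (Function.uncurry fun x b => hess (f x) b j l) :=
  contDiff_grad (contDiff_grad hf j) l

theorem fderiv_apply_eq_sum_grad {p : ℕ} (f : (Fin p → ℝ) → ℝ) (b v : Fin p → ℝ) :
    fderiv ℝ f b v = ∑ j, grad f b j * v j := by
  conv_lhs => rw [← Finset.univ_sum_single v]
  rw [map_sum]
  refine Finset.sum_congr rfl fun j _ => ?_
  have : (Pi.single j (v j) : Fin p → ℝ) = v j • Pi.single j 1 := by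
    rw [← Pi.single_smul, smul_eq_mul, mul_one]
  rw [this, map_smul, smul_eq_mul, grad, mul_comm]

/-- The slope functions of Hadamard's lemma. -/
noncomputable def slopeFun {p : ℕ} (f : (Fin p → ℝ) → ℝ) (b₀ b : Fin p → ℝ) (j : Fin p) : ℝ :=
  ∫ t in (0 : ℝ)..1, grad f (b₀ + t • (b - b₀)) j

theorem slopeFun_self {p : ℕ} (f : (Fin p → ℝ) → ℝ) (b₀ : Fin p → ℝ) (j : Fin p) :
    slopeFun f b₀ b₀ j = grad f b₀ j := by
  simp [slopeFun]

/-- Joint continuity lets the uniform law of large numbers apply to averages of slopes at an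
estimator. Integrating along the segment avoids choosing a mean value point for each observation. -/
theorem continuous_slopeFun {𝒳 : Type*} [NormedAddCommGroup 𝒳] [NormedSpace ℝ 𝒳] {p : ℕ}
    {f : 𝒳 → (Fin p → ℝ) → ℝ} (hf : ContDiff ℝ ∞ (Function.uncurry f)) (b₀ : Fin p → ℝ)
    (j : Fin p) : Continuous (Function.uncurry fun x b => slopeFun (f x) b₀ b j) := by
  have h := (contDiff_grad hf j).continuous
  refine intervalIntegral.continuous_parametric_intervalIntegral_of_continuous'
    (f := fun (z : 𝒳 × (Fin p → ℝ)) t => grad (f z.1) (b₀ + t • (z.2 - b₀)) j) ?_ 0 1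
  exact h.comp (Continuous.prodMk (by fun_prop) (by fun_prop) :
    Continuous fun q : (𝒳 × (Fin p → ℝ)) × ℝ => (q.1.1, b₀ + q.2 • (q.1.2 - b₀)))

/-- **Hadamard's lemma**. -/
theorem sub_eq_sum_slopeFun {p : ℕ} {f : (Fin p → ℝ) → ℝ} (hf : ContDiff ℝ ∞ f)
    (b₀ b : Fin p → ℝ) : f b - f b₀ = ∑ j, slopeFun f b₀ b j * (b j - b₀ j) := by
  have hd : ∀ t : ℝ, HasDerivAt (fun t : ℝ => f (b₀ + t • (b - b₀)))
      (∑ j, grad f (b₀ + t • (b - b₀)) j * (b j - b₀ j)) t := by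
    intro t
    have h1 : HasDerivAt (fun t : ℝ => b₀ + t • (b - b₀)) (b - b₀) t := by
      simpa using ((hasDerivAt_id t).smul_const (b - b₀)).const_add b₀
    have h2 : HasFDerivAt f (fderiv ℝ f (b₀ + t • (b - b₀))) (b₀ + t • (b - b₀)) :=
      (hf.differentiable (by simp) _).hasFDerivAt
    have h3 := h2.comp_hasDerivAt t h1
    rw [fderiv_apply_eq_sum_grad] at h3
    exact h3
  have hg : ∀ j, Continuous fun t : ℝ => grad f (b₀ + t • (b - b₀)) j := by
    intro j
    have h : Continuous fun b => grad f b j := by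
      have := (contDiff_grad (𝒳 := ℝ) (f := fun _ => f) (hf.comp contDiff_snd) j).continuous
      exact this.comp (Continuous.prodMk (continuous_const (y := (0 : ℝ))) continuous_id)
    exact h.comp (by fun_prop)
  have hI := intervalIntegral.integral_eq_sub_of_hasDerivAt (a := 0) (b := 1) (fun t _ => hd t)
    ((continuous_finsetSum _ fun j _ => (hg j).mul continuous_const).intervalIntegrable 0 1)
  simp only [one_smul, zero_smul, add_zero, add_sub_cancel] at hI
  rw [← hI, intervalIntegral.integral_finsetSum (f := fun j t =>
    grad f (b₀ + t • (b - b₀)) j * (b j - b₀ j))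
    fun j _ => ((hg j).mul continuous_const).intervalIntegrable 0 1]
  simp [slopeFun]

/-- The outcome space is finite and discrete, so the outcome may be held fixed. Denominators are
then of the form `condC (numOnes y)`, which are positive. -/
theorem continuous_uncurry_obs {T p : ℕ} {E : Type*} [TopologicalSpace E]
    {f : Covariates T p → Outcomes T → E → ℝ}
    (hf : ∀ y, Continuous (Function.uncurry fun x b => f x y b)) :
    Continuous (Function.uncurry fun (w : Covariates T p × Outcomes T) b => f w.1 w.2 b) := by
  have h : Continuous fun q : (Covariates T p × E) × Outcomes T => f q.1.1 q.2 q.1.2 :=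
    continuous_prod_of_discrete_right.2 fun y => hf y
  exact h.comp (Continuous.prodMk (by fun_prop) (by fun_prop) :
    Continuous fun z : (Covariates T p × Outcomes T) × E => ((z.1.1, z.2), z.1.2))

/-! ### Smoothness of the functions of the model -/

section Model

variable {T p : ℕ}

theorem numOnes_le (y : Outcomes T) : numOnes y ≤ T := by
  calc numOnes y ≤ ∑ _t : Fin T, 1 := Finset.sum_le_sum fun t _ => by have := (y t).isLt; omega
    _ = T := by simp

/-- `∑_t y_t x_t`. -/
def suffStat (x : Covariates T p) (y : Outcomes T) : Fin p → ℝ :=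
  fun j => ∑ t, ((y t : ℕ) : ℝ) * x t j

theorem sum_mul_dotProduct (x : Covariates T p) (y : Outcomes T) (b : Fin p → ℝ) :
    ∑ t, ((y t : ℕ) : ℝ) * (x t ⬝ᵥ b) = suffStat x y ⬝ᵥ b := by
  simp only [suffStat, dotProduct, Finset.mul_sum, Finset.sum_mul]
  rw [Finset.sum_comm]
  simp only [mul_assoc]

theorem condC_eq (k : ℕ) (x : Covariates T p) (b : Fin p → ℝ) :
    condC k x b = ∑ d : Outcomes T with numOnes d = k, Real.exp (suffStat x d ⬝ᵥ b) := by
  simp only [condC, sum_mul_dotProduct]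

theorem condLogLik_eq (y : Outcomes T) (x : Covariates T p) (b : Fin p → ℝ) :
    condLogLik y x b = suffStat x y ⬝ᵥ b - Real.log (condC (numOnes y) x b) := by
  simp only [condLogLik, sum_mul_dotProduct]

theorem condC_pos (y : Outcomes T) (x : Covariates T p) (b : Fin p → ℝ) :
    0 < condC (numOnes y) x b :=
  Finset.sum_pos (fun _ _ => Real.exp_pos _) ⟨y, by simp⟩

theorem contDiff_dotProduct_period (t : Fin T) :
    ContDiff ℝ ∞ fun z : Covariates T p × (Fin p → ℝ) => z.1 t ⬝ᵥ z.2 := by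
  unfold dotProduct
  fun_prop

theorem contDiff_condC (k : ℕ) :
    ContDiff ℝ ∞ (Function.uncurry fun (x : Covariates T p) b => condC k x b) := by
  have h := contDiff_dotProduct_period (T := T) (p := p)
  unfold Function.uncurry condC
  fun_prop

theorem contDiff_condLogLik (y : Outcomes T) :
    ContDiff ℝ ∞ (Function.uncurry fun (x : Covariates T p) b => condLogLik y x b) := by
  have h := contDiff_dotProduct_period (T := T) (p := p)
  have h2 : ContDiff ℝ ∞ fun z : Covariates T p × (Fin p → ℝ) =>
      Real.log (condC (numOnes y) z.1 z.2) :=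
    (contDiff_condC (numOnes y)).log fun z => (condC_pos y z.1 z.2).ne'
  unfold Function.uncurry condLogLik
  fun_prop

variable [NeZero T]

theorem contDiff_weight (t : ℕ) (y : Outcomes T) :
    ContDiff ℝ ∞ (Function.uncurry fun (x : Covariates T p) b => weight t (numOnes y) x b) := by
  have h := contDiff_dotProduct_period (T := T) (p := p)
  unfold Function.uncurry weight
  exact ContDiff.div (by fun_prop) (contDiff_condC _) fun z => (condC_pos y z.1 z.2).ne'

/-- Coefficients of a product are finite convolutions of those of its factors; the induction must
therefore run over all coefficients at once. -/
theorem contDiff_lam (t : ℕ) :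
    ContDiff ℝ ∞ (Function.uncurry fun (x : Covariates T p) b => lam t x b) := by
  have hprod : ∀ (s : Finset (Fin T)) (m : ℕ), ContDiff ℝ ∞ fun z : Covariates T p × (Fin p → ℝ) =>
      (∏ t ∈ s, (Polynomial.X * Polynomial.C
        (Real.exp ((z.1 t - z.1 (lastPeriod T)) ⬝ᵥ z.2) - 1) + 1)).coeff m := by
    intro s
    induction s using Finset.induction_on with
    | empty => intro m; simpa using contDiff_const
    | insert a s ha ih =>
      intro m
      simp only [Finset.prod_insert ha, Polynomial.coeff_mul]
      refine ContDiff.sum fun q _ => ContDiff.mul ?_ (ih _)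
      simp only [Polynomial.coeff_add, Polynomial.coeff_mul_C, sub_dotProduct]
      have h := contDiff_dotProduct_period (T := T) (p := p)
      fun_prop
  unfold Function.uncurry lam lambdaPoly
  simp only [Polynomial.coeff_mul]
  exact ContDiff.sum fun q _ => contDiff_const.mul (hprod _ _)

theorem contDiff_pFun (y : Outcomes T) :
    ContDiff ℝ ∞ (Function.uncurry fun (x : Covariates T p) b => pFun x (numOnes y) b) := by
  unfold Function.uncurry pFun
  exact ContDiff.sum fun t _ => ((contDiff_lam t).add (contDiff_const.mul (contDiff_lam _))).mul
    (contDiff_weight t y)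

end Model

end Smoothness

/-! ### The conditional likelihood as an exponential family -/

section CondLik

variable {T p : ℕ}

theorem exp_condLogLik (y : Outcomes T) (x : Covariates T p) (b : Fin p → ℝ) :
    Real.exp (condLogLik y x b) = Real.exp (suffStat x y ⬝ᵥ b) / condC (numOnes y) x b := by
  rw [condLogLik_eq, Real.exp_sub, Real.exp_log (condC_pos y x b)]

theorem sum_exp_condLogLik (y : Outcomes T) (x : Covariates T p) (b : Fin p → ℝ) :
    ∑ d : Outcomes T with numOnes d = numOnes y, Real.exp (condLogLik d x b) = 1 := by
  have h : ∀ d ∈ Finset.univ.filter (fun d : Outcomes T => numOnes d = numOnes y),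
      Real.exp (condLogLik d x b) = Real.exp (suffStat x d ⬝ᵥ b) / condC (numOnes y) x b := by
    intro d hd
    rw [exp_condLogLik, (Finset.mem_filter.1 hd).2]
  rw [Finset.sum_congr rfl h, ← Finset.sum_div, ← condC_eq, div_self (condC_pos y x b).ne']

/-- Convexity of `log C_s`: dividing `C_s` at a convex combination by the weighted geometric mean of
its values at the endpoints leaves a sum of weighted geometric means of conditional probabilities.
Each is at most the arithmetic mean, by convexity of `exp`, and the arithmetic means add up to one.
-/
theorem concaveOn_condLogLik (y : Outcomes T) (x : Covariates T p) :
    ConcaveOn ℝ Set.univ (condLogLik y x) := by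
  refine ⟨convex_univ, fun a _ b _ s t hs ht hst => ?_⟩
  set c := s • a + t • b with hc
  set L := s * Real.log (condC (numOnes y) x a) + t * Real.log (condC (numOnes y) x b) with hL
  have hlin : ∀ d, suffStat x d ⬝ᵥ c = s * (suffStat x d ⬝ᵥ a) + t * (suffStat x d ⬝ᵥ b) := by
    intro d
    rw [hc, dotProduct_add, dotProduct_smul, dotProduct_smul, smul_eq_mul, smul_eq_mul]
  have hle : condC (numOnes y) x c * Real.exp (-L) ≤ 1 := by
    rw [condC_eq, Finset.sum_mul]
    calc ∑ d : Outcomes T with numOnes d = numOnes y, Real.exp (suffStat x d ⬝ᵥ c) * Real.exp (-L)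
        ≤ ∑ d : Outcomes T with numOnes d = numOnes y, (s * Real.exp (condLogLik d x a) +
            t * Real.exp (condLogLik d x b)) := by
          refine Finset.sum_le_sum fun d hd => ?_
          have h := convexOn_exp.2 (Set.mem_univ (condLogLik d x a))
            (Set.mem_univ (condLogLik d x b)) hs ht hst
          simp only [smul_eq_mul] at h
          refine le_of_eq_of_le ?_ h
          rw [← Real.exp_add, hlin, condLogLik_eq, condLogLik_eq, (Finset.mem_filter.1 hd).2, hL]
          congr 1
          ring
      _ = 1 := by
          rw [Finset.sum_add_distrib, ← Finset.mul_sum, ← Finset.mul_sum, sum_exp_condLogLik,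
            sum_exp_condLogLik]
          linarith
  have hlog : Real.log (condC (numOnes y) x c) ≤ L := by
    rw [Real.log_le_iff_le_exp (condC_pos y x c)]
    rwa [Real.exp_neg, ← div_eq_mul_inv, div_le_one (Real.exp_pos _)] at hle
  simp only [smul_eq_mul, condLogLik_eq, hlin]
  rw [hL] at hlog
  linarith

/-- The conditional mean of `∑_t Y_t X_t` given `X = x` and `S = numOnes y`. -/
noncomputable def meanStat (y : Outcomes T) (x : Covariates T p) (b : Fin p → ℝ) (j : Fin p) : ℝ :=
  ∑ d : Outcomes T with numOnes d = numOnes y, suffStat x d j * Real.exp (condLogLik d x b)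

theorem differentiable_condLogLik (y : Outcomes T) (x : Covariates T p) :
    Differentiable ℝ (condLogLik y x) :=
  (contDiff_of_uncurry (contDiff_condLogLik y) x).differentiable (by simp)

/-- In an exponential family the derivative of the log-partition function is the mean of the
sufficient statistic. -/
theorem grad_condLogLik (y : Outcomes T) (x : Covariates T p) (b : Fin p → ℝ) (j : Fin p) :
    grad (condLogLik y x) b j = suffStat x y j - meanStat y x b j := by
  have hdot : ∀ d, HasFDerivAt (fun b : Fin p → ℝ => suffStat x d ⬝ᵥ b)
      (∑ l, suffStat x d l • (ContinuousLinearMap.proj l : (Fin p → ℝ) →L[ℝ] ℝ)) b := by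
    intro d
    unfold dotProduct
    exact HasFDerivAt.fun_sum fun l _ => (hasFDerivAt_apply l b).const_mul _
  have hC : HasFDerivAt (fun b => ∑ d : Outcomes T with numOnes d = numOnes y,
      Real.exp (suffStat x d ⬝ᵥ b)) _ b := HasFDerivAt.fun_sum fun d _ => (hdot d).exp
  have hpos : ∑ d : Outcomes T with numOnes d = numOnes y, Real.exp (suffStat x d ⬝ᵥ b) ≠ 0 := by
    rw [← condC_eq]; exact (condC_pos y x b).ne'
  have h := (hdot y).fun_sub (hC.log hpos)
  have heq : condLogLik y x = fun b => suffStat x y ⬝ᵥ b -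
      Real.log (∑ d : Outcomes T with numOnes d = numOnes y, Real.exp (suffStat x d ⬝ᵥ b)) := by
    ext b; rw [condLogLik_eq, condC_eq]
  have hsingle : ∀ d, (∑ l, suffStat x d l • (ContinuousLinearMap.proj l : (Fin p → ℝ) →L[ℝ] ℝ))
      (Pi.single j 1) = suffStat x d j := by
    intro d
    simp [Pi.single_apply]
  rw [grad, heq, h.fderiv, sub_apply, hsingle]
  congr 1
  rw [smul_apply, sum_apply, meanStat, smul_eq_mul,
    Finset.mul_sum]
  refine Finset.sum_congr rfl fun d hd => ?_
  rw [smul_apply, hsingle, smul_eq_mul, exp_condLogLik,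
    (Finset.mem_filter.1 hd).2, condC_eq]
  ring

theorem sum_centered_suffStat (y : Outcomes T) (x : Covariates T p) (b : Fin p → ℝ) (j : Fin p) :
    ∑ d : Outcomes T with numOnes d = numOnes y,
      (suffStat x d j - meanStat y x b j) * Real.exp (condLogLik d x b) = 0 := by
  simp only [sub_mul, Finset.sum_sub_distrib, ← Finset.mul_sum, sum_exp_condLogLik, mul_one]
  exact sub_self _

theorem meanStat_congr {y d : Outcomes T} (h : numOnes d = numOnes y) (x : Covariates T p)
    (b : Fin p → ℝ) (j : Fin p) : meanStat d x b j = meanStat y x b j := by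
  simp only [meanStat, h]

/-- Each probability has derivative equal to itself times its score, so differentiating the mean
gives a covariance. The derivative centers one factor only; the other may be centered because
`sum_centered_suffStat` makes the correction vanish. -/
theorem hess_condLogLik (y : Outcomes T) (x : Covariates T p) (b : Fin p → ℝ) (j l : Fin p) :
    hess (condLogLik y x) b j l = -∑ d : Outcomes T with numOnes d = numOnes y,
      (suffStat x d j - meanStat y x b j) * (suffStat x d l - meanStat y x b l) *
        Real.exp (condLogLik d x b) := by
  have hfun : (fun b => grad (condLogLik y x) b j) = fun b => suffStat x y j -
      ∑ d : Outcomes T with numOnes d = numOnes y,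
        suffStat x d j * Real.exp (condLogLik d x b) := by
    ext b; rw [grad_condLogLik, meanStat]
  have hd : HasFDerivAt (fun b => suffStat x y j -
      ∑ d : Outcomes T with numOnes d = numOnes y,
        suffStat x d j * Real.exp (condLogLik d x b)) _ b :=
    (HasFDerivAt.fun_sum fun d _ =>
      ((differentiable_condLogLik d x b).hasFDerivAt.exp.const_mul (suffStat x d j))).const_sub
        (suffStat x y j)
  have h0 := sum_centered_suffStat y x b l
  rw [hess, Matrix.of_apply, hfun, grad, hd.fderiv, neg_apply,
    sum_apply]
  congr 1
  have h1 : ∀ d ∈ Finset.univ.filter (fun d : Outcomes T => numOnes d = numOnes y),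
      (suffStat x d j • Real.exp (condLogLik d x b) • fderiv ℝ (condLogLik d x) b)
        (Pi.single l 1) = suffStat x d j * ((suffStat x d l - meanStat y x b l) *
          Real.exp (condLogLik d x b)) := by
    intro d hd
    have := grad_condLogLik d x b l
    rw [meanStat_congr (Finset.mem_filter.1 hd).2] at this
    rw [smul_apply, smul_apply, smul_eq_mul, smul_eq_mul,
      ← this, grad]
    ring
  rw [Finset.sum_congr rfl h1, ← sub_eq_zero, ← Finset.sum_sub_distrib]
  rw [← mul_zero (meanStat y x b j), ← h0, Finset.mul_sum]
  refine Finset.sum_congr rfl fun d _ => ?_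
  ring

theorem quadForm_hess_condLogLik (y : Outcomes T) (x : Covariates T p) (b v : Fin p → ℝ) :
    ∑ j, ∑ l, v j * v l * hess (condLogLik y x) b j l =
      -∑ d : Outcomes T with numOnes d = numOnes y,
        (∑ j, (suffStat x d j - meanStat y x b j) * v j) ^ 2 * Real.exp (condLogLik d x b) := by
  simp only [hess_condLogLik, mul_neg, Finset.sum_neg_distrib, sq, Finset.sum_mul, Finset.mul_sum]
  congr 1
  rw [Finset.sum_congr rfl fun j _ => Finset.sum_comm, Finset.sum_comm]
  refine Finset.sum_congr rfl fun d _ => Finset.sum_congr rfl fun j _ =>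
    Finset.sum_congr rfl fun l _ => ?_
  ring

/-- The outcome with a single one, in period `t`. -/
def unitOutcome (t : Fin T) : Outcomes T := Pi.single t 1

theorem numOnes_unitOutcome (t : Fin T) : numOnes (unitOutcome t) = 1 := by
  unfold numOnes unitOutcome
  rw [Finset.sum_eq_single t]
  · simp
  · intro s _ hs; simp [hs]
  · simp

theorem suffStat_unitOutcome (x : Covariates T p) (t : Fin T) (j : Fin p) :
    suffStat x (unitOutcome t) j = x t j := by
  unfold suffStat unitOutcome
  rw [Finset.sum_eq_single t]
  · simp
  · intro s _ hs; simp [hs]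
  · simp

/-- The conditional Kullback-Leibler divergence, up to sign. -/
noncomputable def condKL (y : Outcomes T) (x : Covariates T p) (b b₀ : Fin p → ℝ) : ℝ :=
  ∑ d : Outcomes T with numOnes d = numOnes y,
    (condLogLik d x b - condLogLik d x b₀) * Real.exp (condLogLik d x b₀)

/-- Both families of conditional probabilities sum to one, so for the log-likelihood ratio `u` the
variable `exp u - 1` has mean zero under `b₀` and can be subtracted. The terms `exp u - u - 1` are
nonnegative and vanish only at `u = 0`. -/
theorem condKL_eq (y : Outcomes T) (x : Covariates T p) (b b₀ : Fin p → ℝ) :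
    condKL y x b b₀ = -∑ d : Outcomes T with numOnes d = numOnes y,
      (Real.exp (condLogLik d x b - condLogLik d x b₀) - (condLogLik d x b - condLogLik d x b₀) - 1)
        * Real.exp (condLogLik d x b₀) := by
  have h1 : ∀ d, (Real.exp (condLogLik d x b - condLogLik d x b₀) -
      (condLogLik d x b - condLogLik d x b₀) - 1) * Real.exp (condLogLik d x b₀) =
      Real.exp (condLogLik d x b) - (condLogLik d x b - condLogLik d x b₀) *
        Real.exp (condLogLik d x b₀) - Real.exp (condLogLik d x b₀) := by
    intro d
    rw [sub_mul, sub_mul, ← Real.exp_add]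
    ring_nf
  simp only [h1, Finset.sum_sub_distrib, sum_exp_condLogLik]
  simp [condKL]

theorem condKL_nonpos (y : Outcomes T) (x : Covariates T p) (b b₀ : Fin p → ℝ) :
    condKL y x b b₀ ≤ 0 := by
  rw [condKL_eq]
  refine neg_nonpos.2 (Finset.sum_nonneg fun d _ => mul_nonneg ?_ (Real.exp_pos _).le)
  linarith [Real.add_one_le_exp (condLogLik d x b - condLogLik d x b₀)]

theorem condLogLik_eq_of_condKL_eq_zero {y : Outcomes T} {x : Covariates T p} {b b₀ : Fin p → ℝ}
    (h : condKL y x b b₀ = 0) : condLogLik y x b = condLogLik y x b₀ := by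
  rw [condKL_eq, neg_eq_zero, Finset.sum_eq_zero_iff_of_nonneg] at h
  · have h1 := h y (by simp)
    rw [mul_eq_zero, or_iff_left (Real.exp_pos _).ne'] at h1
    by_contra hne
    have := Real.add_one_lt_exp (sub_ne_zero.2 hne)
    linarith
  · intro d _
    refine mul_nonneg ?_ (Real.exp_pos _).le
    linarith [Real.add_one_le_exp (condLogLik d x b - condLogLik d x b₀)]

end CondLik

/-! ### The law of the outcomes given the covariates and the individual effect -/

/-- A continuous cdf has no atoms. The open half-line is the one needed, a zero outcome being a
strict inequality on the error. -/
theorem logistic_measure_Iio {ν : Measure ℝ} [IsProbabilityMeasure ν]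
    (h : ∀ z, ν.real (Set.Iic z) = 1 / (1 + Real.exp (-z))) (z : ℝ) :
    ν.real (Set.Iio z) = 1 / (1 + Real.exp (-z)) := by
  refine le_antisymm ((measureReal_mono Set.Iio_subset_Iic_self).trans_eq (h z)) ?_
  have hc : Continuous fun z : ℝ => 1 / (1 + Real.exp (-z)) :=
    continuous_const.div (by fun_prop) fun z => by positivity
  have ht : Tendsto (fun u : ℝ => 1 / (1 + Real.exp (-u))) (𝓝[<] z)
      (𝓝 (1 / (1 + Real.exp (-z)))) := (hc.tendsto z).mono_left nhdsWithin_le_nhds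
  refine le_of_tendsto ht ?_
  filter_upwards [self_mem_nhdsWithin] with u hu
  rw [← h u]
  exact measureReal_mono fun v hv => lt_of_le_of_lt (Set.mem_Iic.1 hv) hu

/-- The outcomes as a function of the covariates, the individual effect and the errors. -/
noncomputable def outcomeFun {T p : ℕ} (β₀ : Fin p → ℝ) (x : Covariates T p) (a : ℝ) (e : Fin T → ℝ) :
    Outcomes T := fun t => if 0 ≤ x t ⬝ᵥ β₀ + a + e t then 1 else 0

theorem measurable_outcomeFun {T p : ℕ} (β₀ : Fin p → ℝ) :
    Measurable fun z : (Fin T → ℝ) × (ℝ × Covariates T p) => outcomeFun β₀ z.2.2 z.2.1 z.1 := by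
  refine measurable_pi_lambda _ fun t => ?_
  refine Measurable.ite ?_ measurable_const measurable_const
  refine measurableSet_le measurable_const ?_
  unfold dotProduct
  fun_prop

/-- The factor of the likelihood of an outcome vector that depends on the individual effect. -/
noncomputable def effectFactor {T p : ℕ} (β₀ : Fin p → ℝ) (x : Covariates T p) (a : ℝ) (s : ℕ) :
    ℝ :=
  condC s x β₀ * Real.exp (s * a) / ∏ t, (1 + Real.exp (x t ⬝ᵥ β₀ + a))

theorem effectFactor_pos {T p : ℕ} (β₀ : Fin p → ℝ) (x : Covariates T p) (a : ℝ)
    (y : Outcomes T) : 0 < effectFactor β₀ x a (numOnes y) :=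
  div_pos (mul_pos (condC_pos y x β₀) (Real.exp_pos _)) (Finset.prod_pos fun t _ => by positivity)

/-- Independence gives a product over periods of `exp (y_t (x_t'β₀ + a)) / (1 + exp (x_t'β₀ + a))`.
The effect enters its numerator only through the number of ones, so multiplying and dividing by
`condC` isolates the conditional likelihood. -/
theorem measure_outcomeFun_eq {T p : ℕ} {ν : Fin T → Measure ℝ} [∀ t, IsProbabilityMeasure (ν t)]
    (h : ∀ t z, (ν t).real (Set.Iic z) = 1 / (1 + Real.exp (-z))) (β₀ : Fin p → ℝ)
    (x : Covariates T p) (a : ℝ) (y : Outcomes T) :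
    (Measure.pi ν).real {e | outcomeFun β₀ x a e = y} =
      Real.exp (condLogLik y x β₀) * effectFactor β₀ x a (numOnes y) := by
  have hset : {e | outcomeFun β₀ x a e = y} = Set.pi Set.univ fun t =>
      if y t = 1 then (Set.Iio (-(x t ⬝ᵥ β₀ + a)))ᶜ else Set.Iio (-(x t ⬝ᵥ β₀ + a)) := by
    ext e
    simp only [Set.mem_ofPred_eq, Set.mem_pi, Set.mem_univ, true_imp_iff, funext_iff, outcomeFun]
    refine forall_congr' fun t => ?_
    have hy : y t = 0 ∨ y t = 1 := by have := (y t).isLt; omega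
    rcases hy with hy | hy
    · simp only [hy]
      by_cases h0 : 0 ≤ x t ⬝ᵥ β₀ + a + e t
      · simp only [h0, if_true]; simp; linarith
      · simp only [h0, if_false]; simp; linarith
    · simp only [hy]
      by_cases h0 : 0 ≤ x t ⬝ᵥ β₀ + a + e t
      · simp only [h0, if_true]; simp; linarith
      · simp only [h0, if_false]; simp; linarith
  have hreal : (Measure.pi ν).real {e | outcomeFun β₀ x a e = y} =
      ∏ t, Real.exp (((y t : ℕ) : ℝ) * (x t ⬝ᵥ β₀ + a)) / (1 + Real.exp (x t ⬝ᵥ β₀ + a)) := by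
    rw [hset, measureReal_def, Measure.pi_pi, ENNReal.toReal_prod]
    refine Finset.prod_congr rfl fun t _ => ?_
    have hy : y t = 0 ∨ y t = 1 := by have := (y t).isLt; omega
    have hIio := logistic_measure_Iio (h t) (-(x t ⬝ᵥ β₀ + a))
    rw [neg_neg] at hIio
    rcases hy with hy | hy
    · simp only [hy]
      simpa [measureReal_def] using hIio
    · simp only [hy, if_true]
      have := probReal_compl_eq_one_sub (μ := ν t)
        (measurableSet_Iio (a := -(x t ⬝ᵥ β₀ + a)))
      rw [← measureReal_def, this, hIio]
      simp only [Fin.val_one, Nat.cast_one, one_mul]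
      field_simp
      ring
  have hC := (condC_pos y x β₀).ne'
  rw [hreal, Finset.prod_div_distrib, ← Real.exp_sum, exp_condLogLik, effectFactor]
  have hsum : ∑ t, ((y t : ℕ) : ℝ) * (x t ⬝ᵥ β₀ + a) =
      suffStat x y ⬝ᵥ β₀ + (numOnes y : ℝ) * a := by
    simp only [mul_add, Finset.sum_add_distrib, sum_mul_dotProduct, ← Finset.sum_mul, numOnes,
      Nat.cast_sum]
  rw [hsum, Real.exp_add]
  field_simp

/-! ### Expectations of functions of an observation -/

section Sample

variable {Ω : Type*} [MeasurableSpace Ω] {P : Measure Ω} [IsProbabilityMeasure P] {T p : ℕ}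
  {X : ℕ → Ω → Covariates T p} {α : ℕ → Ω → ℝ} {ε : ℕ → Ω → Fin T → ℝ}
  {Y : ℕ → Ω → Outcomes T} {β₀ : Fin p → ℝ}

omit [IsProbabilityMeasure P] in
theorem IsSample.outcome_eq (h : IsSample P X α ε Y β₀) (i : ℕ) (ω : Ω) :
    Y i ω = outcomeFun β₀ (X i ω) (α i ω) (ε i ω) :=
  funext fun t => h.outcome i ω t

omit [IsProbabilityMeasure P] in
theorem IsSample.isCompactIID (h : IsSample P X α ε Y β₀)
    (hsupp : IsCompact (P.map (X 0)).support) :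
    IsCompactIID P (fun i ω => (X i ω, Y i ω))
      ((P.map (X 0)).support ×ˢ (Set.univ : Set (Outcomes T))) := by
  let F : Covariates T p × ℝ × (Fin T → ℝ) → Covariates T p × Outcomes T :=
    fun z => (z.1, outcomeFun β₀ z.1 z.2.1 z.2.2)
  have hF : Measurable F := by
    refine measurable_fst.prodMk ((measurable_outcomeFun β₀).comp
      (g := fun z : (Fin T → ℝ) × (ℝ × Covariates T p) => outcomeFun β₀ z.2.2 z.2.1 z.1)
      (f := fun z : Covariates T p × ℝ × (Fin T → ℝ) => (z.2.2, (z.2.1, z.1))) ?_)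
    fun_prop
  have hW : (fun i ω => (X i ω, Y i ω)) = fun i => F ∘ fun ω => (X i ω, α i ω, ε i ω) := by
    funext i ω
    exact Prod.ext rfl (h.outcome_eq i ω)
  have hm : ∀ i, Measurable fun ω => (X i ω, α i ω, ε i ω) := fun i =>
    (h.measurable_X i).prodMk ((h.measurable_α i).prodMk (h.measurable_ε i))
  refine ⟨fun i => ?_, ?_, fun i => ?_, ?_, ?_⟩
  · exact (congrFun hW i).symm ▸ hF.comp (hm i)
  · exact hW.symm ▸ h.indep.comp (fun _ => F) fun _ => hF
  · have hi := (h.ident i).comp hF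
    rwa [← congrFun hW i, ← congrFun hW 0] at hi
  · exact hsupp.prod isCompact_univ
  · have : ∀ᵐ x ∂(P.map (X 0)), x ∈ (P.map (X 0)).support := Measure.support_mem_ae
    filter_upwards [ae_of_ae_map (h.measurable_X 0).aemeasurable this] with ω hω
    exact ⟨hω, Set.mem_univ _⟩

/-- The law of the outcomes given the covariates and the individual effect. -/
theorem IsSample.integral_indicator_outcome (h : IsSample P X α ε Y β₀) {g : Covariates T p → ℝ}
    (hg : Measurable g) (hgi : Integrable (fun ω => g (X 0 ω)) P) (y : Outcomes T) :
    Integrable (fun ω => g (X 0 ω) * (Real.exp (condLogLik y (X 0 ω) β₀) *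
        effectFactor β₀ (X 0 ω) (α 0 ω) (numOnes y))) P ∧
    ∫ ω, (if Y 0 ω = y then g (X 0 ω) else 0) ∂P =
      ∫ ω, g (X 0 ω) * (Real.exp (condLogLik y (X 0 ω) β₀) *
        effectFactor β₀ (X 0 ω) (α 0 ω) (numOnes y)) ∂P := by
  have hαX : Measurable fun ω => (α 0 ω, X 0 ω) := (h.measurable_α 0).prodMk (h.measurable_X 0)
  set ν : Fin T → Measure ℝ := fun t => P.map fun ω => ε 0 ω t with hν
  have hεt : ∀ t, Measurable fun ω => ε 0 ω t := fun t =>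
    (measurable_pi_apply t).comp (h.measurable_ε 0)
  have hνp : ∀ t, IsProbabilityMeasure (ν t) := fun t =>
    Measure.isProbabilityMeasure_map (hεt t).aemeasurable
  have hcdf : ∀ t z, (ν t).real (Set.Iic z) = 1 / (1 + Real.exp (-z)) := by
    intro t z
    rw [hν, map_measureReal_apply (hεt t) measurableSet_Iic]
    exact h.logistic_ε 0 t z
  have hpi : P.map (ε 0) = Measure.pi ν :=
    (iIndepFun_iff_map_fun_eq_pi_map fun t => (hεt t).aemeasurable).1 (h.indep_ε 0)
  set μ := P.map fun ω => (α 0 ω, X 0 ω) with hμ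
  have hμp : IsProbabilityMeasure μ := Measure.isProbabilityMeasure_map hαX.aemeasurable
  have hjoint : P.map (fun ω => (ε 0 ω, (α 0 ω, X 0 ω))) = (Measure.pi ν).prod μ := by
    rw [← hpi]
    exact (indepFun_iff_map_prod_eq_prod_map_map (h.measurable_ε 0).aemeasurable
      hαX.aemeasurable).1 (h.indep_ε_αX 0)
  let F : (Fin T → ℝ) × (ℝ × Covariates T p) → ℝ := fun z =>
    if outcomeFun β₀ z.2.2 z.2.1 z.1 = y then g z.2.2 else 0
  have hFm : Measurable F := by
    refine Measurable.ite ?_ (by fun_prop) measurable_const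
    exact measurable_outcomeFun β₀ (measurableSet_singleton y)
  have hem : Measurable fun ω => (ε 0 ω, (α 0 ω, X 0 ω)) := (h.measurable_ε 0).prodMk hαX
  have hgμ : Integrable (fun z : ℝ × Covariates T p => g z.2) μ := by
    rw [hμ, integrable_map_measure (f := fun ω => (α 0 ω, X 0 ω))
      (g := fun z : ℝ × Covariates T p => g z.2) (hg.comp measurable_snd).aestronglyMeasurable
      hαX.aemeasurable]
    exact hgi
  have hFi : Integrable F ((Measure.pi ν).prod μ) := by
    refine (hgμ.comp_snd (Measure.pi ν)).mono hFm.aestronglyMeasurable (ae_of_all _ fun z => ?_)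
    simp only [F]
    split_ifs <;> simp
  have hinner : ∀ z : ℝ × Covariates T p, ∫ e, F (e, z) ∂(Measure.pi ν) =
      g z.2 * (Real.exp (condLogLik y z.2 β₀) * effectFactor β₀ z.2 z.1 (numOnes y)) := by
    intro z
    rw [← measure_outcomeFun_eq hcdf]
    have hs : MeasurableSet {e | outcomeFun β₀ z.2 z.1 e = y} :=
      (measurable_outcomeFun β₀).comp (measurable_id.prodMk measurable_const)
        (measurableSet_singleton y)
    have : (fun e => F (e, z)) = {e | outcomeFun β₀ z.2 z.1 e = y}.indicator fun _ => g z.2 := by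
      ext e; simp [F, Set.indicator_apply]
    rw [this, integral_indicator hs, setIntegral_const, smul_eq_mul, mul_comm]
  have hint2 := hFi.integral_prod_right
  simp only [hinner] at hint2
  constructor
  · rw [hμ, integrable_map_measure hint2.aestronglyMeasurable hαX.aemeasurable] at hint2
    exact hint2
  calc ∫ ω, (if Y 0 ω = y then g (X 0 ω) else 0) ∂P
      = ∫ ω, F (ε 0 ω, (α 0 ω, X 0 ω)) ∂P := by simp only [F, h.outcome_eq]
    _ = ∫ z, F z ∂((Measure.pi ν).prod μ) := by
        rw [← hjoint, integral_map hem.aemeasurable hFm.aestronglyMeasurable]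
    _ = ∫ z, ∫ e, F (e, z) ∂(Measure.pi ν) ∂μ := integral_prod_symm F hFi
    _ = _ := by
        simp only [hinner]
        rw [hμ, integral_map hαX.aemeasurable]
        exact hint2.aestronglyMeasurable

theorem IsSample.integral_obs (h : IsSample P X α ε Y β₀)
    (hsupp : IsCompact (P.map (X 0)).support) {g : Covariates T p → Outcomes T → ℝ}
    (hg : ∀ y, Continuous fun x => g x y) :
    (∀ y, Integrable (fun ω => g (X 0 ω) y * (Real.exp (condLogLik y (X 0 ω) β₀) *
        effectFactor β₀ (X 0 ω) (α 0 ω) (numOnes y))) P) ∧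
    ∫ ω, g (X 0 ω) (Y 0 ω) ∂P =
      ∫ ω, ∑ y, g (X 0 ω) y * (Real.exp (condLogLik y (X 0 ω) β₀) *
        effectFactor β₀ (X 0 ω) (α 0 ω) (numOnes y)) ∂P := by
  have hW := h.isCompactIID hsupp
  have hgi : ∀ y, Integrable (fun ω => g (X 0 ω) y) P := fun y =>
    hW.integrable_comp (g := fun w => g w.1 y) ((hg y).comp continuous_fst)
  have hy := fun y => h.integral_indicator_outcome (hg y).measurable (hgi y) y
  refine ⟨fun y => (hy y).1, ?_⟩
  rw [integral_finsetSum _ fun y _ => (hy y).1, ← Finset.sum_congr rfl fun y _ => (hy y).2]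
  have hYm : Measurable (Y 0) := measurable_snd.comp (hW.measurable 0)
  rw [← integral_finsetSum]
  · congr 1 with ω
    simp
  · intro y _
    have : (fun ω => if Y 0 ω = y then g (X 0 ω) y else 0) =
        ((Y 0) ⁻¹' {y}).indicator fun ω => g (X 0 ω) y := by
      funext ω
      by_cases hω : Y 0 ω = y <;> simp [hω]
    rw [this]
    exact (hgi y).indicator (hYm (measurableSet_singleton y))

/-- A function of the observation has mean zero if its conditional mean given `(X, S)` vanishes. -/
theorem IsSample.integral_obs_eq_zero (h : IsSample P X α ε Y β₀)
    (hsupp : IsCompact (P.map (X 0)).support) {g : Covariates T p → Outcomes T → ℝ}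
    (hg : ∀ y, Continuous fun x => g x y)
    (h0 : ∀ (x : Covariates T p) (y : Outcomes T), ∑ d : Outcomes T with numOnes d = numOnes y,
      g x d * Real.exp (condLogLik d x β₀) = 0) :
    ∫ ω, g (X 0 ω) (Y 0 ω) ∂P = 0 := by
  rw [(h.integral_obs hsupp hg).2]
  refine integral_eq_zero_of_ae (ae_of_all _ fun ω => ?_)
  classical
  change ∑ y, g (X 0 ω) y * (Real.exp (condLogLik y (X 0 ω) β₀) *
        effectFactor β₀ (X 0 ω) (α 0 ω) (numOnes y)) = 0
  -- Within a group of outcomes with equally many ones, the effect factor is constant and comes out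
  -- of the sum, whatever the law of the individual effect.
  rw [← Finset.sum_fiberwise_of_maps_to (s := Finset.univ)
    (t := Finset.univ.image (numOnes : Outcomes T → ℕ)) (g := numOnes)
    (fun y _ => Finset.mem_image_of_mem _ (Finset.mem_univ y))]
  refine Finset.sum_eq_zero fun s hs => ?_
  obtain ⟨y, -, rfl⟩ := Finset.mem_image.1 hs
  calc ∑ d : Outcomes T with numOnes d = numOnes y, g (X 0 ω) d *
        (Real.exp (condLogLik d (X 0 ω) β₀) * effectFactor β₀ (X 0 ω) (α 0 ω) (numOnes d))
      = (∑ d : Outcomes T with numOnes d = numOnes y, g (X 0 ω) d *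
        Real.exp (condLogLik d (X 0 ω) β₀)) * effectFactor β₀ (X 0 ω) (α 0 ω) (numOnes y) := by
        rw [Finset.sum_mul]
        refine Finset.sum_congr rfl fun d hd => ?_
        rw [(Finset.mem_filter.1 hd).2, mul_assoc]
    _ = 0 := by rw [h0, zero_mul]

/-- All outcomes have positive probability given the covariates. -/
theorem IsSample.ae_eq_zero_of_integral_obs (h : IsSample P X α ε Y β₀)
    (hsupp : IsCompact (P.map (X 0)).support) {g : Covariates T p → Outcomes T → ℝ}
    (hg : ∀ y, Continuous fun x => g x y) (hg0 : ∀ x y, 0 ≤ g x y)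
    (h0 : ∫ ω, g (X 0 ω) (Y 0 ω) ∂P = 0) : ∀ᵐ ω ∂P, ∀ y, g (X 0 ω) y = 0 := by
  obtain ⟨hi, he⟩ := h.integral_obs hsupp hg
  rw [h0] at he
  have hnn : ∀ ω y, 0 ≤ g (X 0 ω) y * (Real.exp (condLogLik y (X 0 ω) β₀) *
        effectFactor β₀ (X 0 ω) (α 0 ω) (numOnes y)) := fun ω y =>
    mul_nonneg (hg0 _ _) (mul_nonneg (Real.exp_pos _).le (effectFactor_pos _ _ _ _).le)
  have h1 := (integral_eq_zero_iff_of_nonneg (fun ω => Finset.sum_nonneg fun y _ => hnn ω y)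
    (integrable_finsetSum _ fun y _ => hi y)).1 he.symm
  filter_upwards [h1] with ω hω y
  have h2 := (Finset.sum_eq_zero_iff_of_nonneg fun y _ => hnn ω y).1 hω y (Finset.mem_univ y)
  rw [mul_eq_zero] at h2
  exact h2.resolve_right (mul_pos (Real.exp_pos _) (effectFactor_pos _ _ _ _)).ne'

/-! ### Identification -/

omit [IsProbabilityMeasure P] in
theorem eq_zero_of_forall_sub_dotProduct {X : Ω → Covariates T p}
    (hint : ∀ t t' j l, Integrable (fun ω => (X ω t j - X ω t' j) * (X ω t l - X ω t' l)) P)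
    (hvar : IsUnit (variationMatrix P X)) {v : Fin p → ℝ}
    (hv : ∀ᵐ ω ∂P, ∀ t t', ∑ l, (X ω t l - X ω t' l) * v l = 0) : v = 0 := by
  have hz : (variationMatrix P X).mulVec v = 0 := by
    ext j
    have hil : ∀ l, Integrable (fun ω => (∑ t, ∑ t', (X ω t j - X ω t' j) *
        (X ω t l - X ω t' l)) * v l) P := fun l =>
      (integrable_finsetSum _ fun t _ => integrable_finsetSum _ fun t' _ =>
        hint t t' j l).mul_const _
    simp only [Matrix.mulVec, dotProduct, variationMatrix, Matrix.of_apply, Pi.zero_apply,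
      ← integral_mul_const]
    rw [← integral_finsetSum _ fun l _ => hil l]
    refine integral_eq_zero_of_ae ?_
    filter_upwards [hv] with ω hω
    simp only [Finset.sum_mul, Pi.zero_apply]
    rw [Finset.sum_comm]
    refine Finset.sum_eq_zero fun t _ => ?_
    rw [Finset.sum_comm]
    refine Finset.sum_eq_zero fun t' _ => ?_
    simp only [mul_assoc, ← Finset.mul_sum, hω t t', mul_zero]
  exact Matrix.mulVec_injective_iff_isUnit.2 hvar (hz.trans (Matrix.mulVec_zero _).symm)

theorem IsSample.eq_zero_of_forall_sub_dotProduct (h : IsSample P X α ε Y β₀)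
    (hsupp : IsCompact (P.map (X 0)).support) (hvar : IsUnit (variationMatrix P (X 0)))
    {v : Fin p → ℝ} (hv : ∀ᵐ ω ∂P, ∀ t t', ∑ l, (X 0 ω t l - X 0 ω t' l) * v l = 0) : v = 0 :=
  FELogit.eq_zero_of_forall_sub_dotProduct (fun t t' j l =>
    (h.isCompactIID hsupp).integrable_comp
      (g := fun w => (w.1 t j - w.1 t' j) * (w.1 t l - w.1 t' l)) (by fun_prop)) hvar hv

theorem continuous_condLogLik_left (y : Outcomes T) (b : Fin p → ℝ) :
    Continuous fun x : Covariates T p => condLogLik y x b :=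
  (contDiff_condLogLik y).continuous.comp (continuous_id.prodMk continuous_const)

theorem continuous_condLogLik_obs : Continuous (Function.uncurry
    fun (w : Covariates T p × Outcomes T) b => condLogLik w.2 w.1 b) :=
  continuous_uncurry_obs (f := fun x y b => condLogLik y x b) fun y =>
    (contDiff_condLogLik y).continuous

theorem continuous_obs_left {𝒲 E : Type*} [TopologicalSpace 𝒲] [TopologicalSpace E]
    {f : 𝒲 → E → ℝ} (hf : Continuous (Function.uncurry f)) (b : E) : Continuous fun w => f w b :=
  hf.comp (continuous_id.prodMk continuous_const)

/-- The log-likelihood gap differs from `condKL` by a variable with zero conditional mean given `(X,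
S)`, so its mean is that of `condKL`, which is nonpositive. If it were zero, the likelihoods at `b`
and `β₀` would agree at every outcome, and outcomes with a single one would identify the parameter.
-/
theorem IsSample.integral_condLogLik_lt (h : IsSample P X α ε Y β₀)
    (hsupp : IsCompact (P.map (X 0)).support) (hvar : IsUnit (variationMatrix P (X 0)))
    {b : Fin p → ℝ} (hb : b ≠ β₀) :
    ∫ ω, condLogLik (Y 0 ω) (X 0 ω) b ∂P < ∫ ω, condLogLik (Y 0 ω) (X 0 ω) β₀ ∂P := by
  have hW := h.isCompactIID hsupp
  have hi : ∀ b, Integrable (fun ω => condLogLik (Y 0 ω) (X 0 ω) b) P := fun b =>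
    hW.integrable_comp (g := fun w => condLogLik w.2 w.1 b)
      (continuous_obs_left continuous_condLogLik_obs b)
  have hcont := continuous_condLogLik_left (T := T) (p := p)
  have hKLc : ∀ y, Continuous fun x : Covariates T p => condKL y x b β₀ := by
    intro y
    unfold condKL
    exact continuous_finsetSum _ fun d _ => ((hcont d b).sub (hcont d β₀)).mul
      (Real.continuous_exp.comp (hcont d β₀))
  have hKLi : Integrable (fun ω => condKL (Y 0 ω) (X 0 ω) b β₀) P :=
    hW.integrable_comp (g := fun w => condKL w.2 w.1 b β₀) (continuous_prod_of_discrete_right.2 hKLc)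
  have hdiff : ∫ ω, (condLogLik (Y 0 ω) (X 0 ω) b - condLogLik (Y 0 ω) (X 0 ω) β₀ -
      condKL (Y 0 ω) (X 0 ω) b β₀) ∂P = 0 := by
    refine h.integral_obs_eq_zero hsupp
      (g := fun x y => condLogLik y x b - condLogLik y x β₀ - condKL y x b β₀)
      (fun y => ((hcont y b).sub (hcont y β₀)).sub (hKLc y)) fun x y => ?_
    have h1 : ∀ d ∈ Finset.univ.filter (fun d : Outcomes T => numOnes d = numOnes y),
        (condLogLik d x b - condLogLik d x β₀ - condKL d x b β₀) * Real.exp (condLogLik d x β₀) =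
        (condLogLik d x b - condLogLik d x β₀) * Real.exp (condLogLik d x β₀) -
          condKL y x b β₀ * Real.exp (condLogLik d x β₀) := by
      intro d hd
      rw [sub_mul]
      simp only [condKL, (Finset.mem_filter.1 hd).2]
    rw [Finset.sum_congr rfl h1, Finset.sum_sub_distrib, ← Finset.mul_sum, sum_exp_condLogLik,
      mul_one]
    exact sub_self _
  have hbi : Integrable (fun ω => condLogLik (Y 0 ω) (X 0 ω) b - condLogLik (Y 0 ω) (X 0 ω) β₀) P :=
    (hi b).sub (hi β₀)
  rw [integral_sub hbi hKLi, integral_sub (hi b) (hi β₀)] at hdiff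
  have hle : ∫ ω, condKL (Y 0 ω) (X 0 ω) b β₀ ∂P ≤ 0 :=
    integral_nonpos fun ω => condKL_nonpos _ _ _ _
  have hne : ∫ ω, condKL (Y 0 ω) (X 0 ω) b β₀ ∂P ≠ 0 := by
    intro h0
    have h1 := h.ae_eq_zero_of_integral_obs hsupp (g := fun x y => -condKL y x b β₀)
      (fun y => (hKLc y).neg) (fun x y => neg_nonneg.2 (condKL_nonpos _ _ _ _))
      (by rw [integral_neg, h0, neg_zero])
    refine hb (sub_eq_zero.1 (h.eq_zero_of_forall_sub_dotProduct hsupp hvar ?_))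
    filter_upwards [h1] with ω hω t t'
    have h2 : ∀ t, condLogLik (unitOutcome t) (X 0 ω) b = condLogLik (unitOutcome t) (X 0 ω) β₀ :=
      fun t => condLogLik_eq_of_condKL_eq_zero (neg_eq_zero.1 (hω _))
    have h3 : ∀ (t) (b : Fin p → ℝ), suffStat (X 0 ω) (unitOutcome t) ⬝ᵥ b = X 0 ω t ⬝ᵥ b := by
      intro t b
      congr 1
      ext j
      exact suffStat_unitOutcome _ _ _
    have ht := h2 t
    have ht' := h2 t'
    rw [condLogLik_eq, condLogLik_eq, numOnes_unitOutcome, h3, h3] at ht ht'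
    -- The outcomes with a single one share the normalizer `C_1`, which cancels in the difference
    -- between two periods.
    have : ∑ l, (X 0 ω t l - X 0 ω t' l) * (b - β₀) l =
        (X 0 ω t ⬝ᵥ b - X 0 ω t ⬝ᵥ β₀) - (X 0 ω t' ⬝ᵥ b - X 0 ω t' ⬝ᵥ β₀) := by
      simp only [dotProduct, ← Finset.sum_sub_distrib]
      exact Finset.sum_congr rfl fun l _ => by rw [Pi.sub_apply]; ring
    rw [this]
    linarith
  have := lt_of_le_of_ne hle hne
  linarith

theorem continuous_grad_condLogLik (j : Fin p) : Continuous (Function.uncurry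
    fun (w : Covariates T p × Outcomes T) b => grad (condLogLik w.2 w.1) b j) :=
  continuous_uncurry_obs (f := fun x y b => grad (condLogLik y x) b j) fun y =>
    (contDiff_grad (contDiff_condLogLik y) j).continuous

theorem continuous_hess_condLogLik (j l : Fin p) : Continuous (Function.uncurry
    fun (w : Covariates T p × Outcomes T) b => hess (condLogLik w.2 w.1) b j l) :=
  continuous_uncurry_obs (f := fun x y b => hess (condLogLik y x) b j l) fun y =>
    (contDiff_hess (contDiff_condLogLik y) j l).continuous

theorem IsSample.integral_score (h : IsSample P X α ε Y β₀)
    (hsupp : IsCompact (P.map (X 0)).support) (j : Fin p) :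
    ∫ ω, grad (condLogLik (Y 0 ω) (X 0 ω)) β₀ j ∂P = 0 := by
  have hc : ∀ y : Outcomes T, Continuous fun x : Covariates T p => grad (condLogLik y x) β₀ j :=
    fun y => continuous_obs_left (f := fun x b => grad (condLogLik y x) b j)
      (contDiff_grad (contDiff_condLogLik y) j).continuous β₀
  refine h.integral_obs_eq_zero hsupp hc fun x y => ?_
  rw [← sum_centered_suffStat y x β₀ j]
  refine Finset.sum_congr rfl fun d hd => ?_
  rw [grad_condLogLik, meanStat_congr (Finset.mem_filter.1 hd).2]

omit [IsProbabilityMeasure P] in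
theorem integral_quadForm {H : Ω → Fin p → Fin p → ℝ}
    (hH : ∀ j l, Integrable (fun ω => H ω j l) P) (v : Fin p → ℝ) :
    ∫ ω, ∑ j, ∑ l, v j * v l * H ω j l ∂P = ∑ j, v j * ∑ l, (∫ ω, H ω j l ∂P) * v l := by
  rw [integral_finsetSum _ fun j _ => integrable_finsetSum _ fun l _ => (hH j l).const_mul _]
  refine Finset.sum_congr rfl fun j _ => ?_
  rw [integral_finsetSum _ fun l _ => (hH j l).const_mul _, Finset.mul_sum]
  refine Finset.sum_congr rfl fun l _ => ?_
  rw [integral_const_mul]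
  ring

/-- The quadratic form at `v` is the mean conditional variance of the sufficient statistic in
direction `v`. If it vanishes, that statistic is constant on each slice; on the slice with a single
one it takes the values `x_t'v`. -/
theorem IsSample.isUnit_information (h : IsSample P X α ε Y β₀)
    (hsupp : IsCompact (P.map (X 0)).support) (hvar : IsUnit (variationMatrix P (X 0))) :
    IsUnit (information P (X 0) (Y 0) β₀) := by
  have hW := h.isCompactIID hsupp
  rw [← Matrix.mulVec_injective_iff_isUnit]
  have hlin : Function.Injective (Matrix.mulVecLin (information P (X 0) (Y 0) β₀)) := by
    refine (injective_iff_map_eq_zero _).2 fun v hv => ?_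
    rw [Matrix.mulVecLin_apply] at hv
    let g : Covariates T p → Outcomes T → ℝ := fun x y =>
      ∑ d : Outcomes T with numOnes d = numOnes y,
        (∑ j, (suffStat x d j - meanStat y x β₀ j) * v j) ^ 2 * Real.exp (condLogLik d x β₀)
    have hgh : ∀ x y, g x y = -∑ j, ∑ l, v j * v l * hess (condLogLik y x) β₀ j l := by
      intro x y
      rw [quadForm_hess_condLogLik, neg_neg]
    have hgc : ∀ y, Continuous fun x => g x y := by
      intro y
      simp only [hgh]
      refine Continuous.neg (continuous_finsetSum _ fun j _ => continuous_finsetSum _ fun l _ =>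
        continuous_const.mul ?_)
      exact continuous_obs_left (f := fun x b => hess (condLogLik y x) b j l)
        (contDiff_hess (contDiff_condLogLik y) j l).continuous β₀
    have hhi : ∀ j l, Integrable (fun ω => hess (condLogLik (Y 0 ω) (X 0 ω)) β₀ j l) P := by
      intro j l
      have hc : Continuous fun w : Covariates T p × Outcomes T =>
          hess (condLogLik w.2 w.1) β₀ j l := continuous_obs_left
        (f := fun (w : Covariates T p × Outcomes T) b => hess (condLogLik w.2 w.1) b j l)
        (continuous_hess_condLogLik j l) β₀
      exact hW.integrable_comp hc
    have hg0 : ∫ ω, g (X 0 ω) (Y 0 ω) ∂P = 0 := by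
      simp only [hgh]
      rw [integral_neg, integral_quadForm hhi, neg_eq_zero]
      refine Finset.sum_eq_zero fun j _ => ?_
      have hj : ∑ l, (-∫ ω, hess (condLogLik (Y 0 ω) (X 0 ω)) β₀ j l ∂P) * v l = 0 :=
        congrFun hv j
      simp only [neg_mul, Finset.sum_neg_distrib, neg_eq_zero] at hj
      rw [hj, mul_zero]
    have hsq : ∀ x y, 0 ≤ g x y := fun x y =>
      Finset.sum_nonneg fun d _ => mul_nonneg (sq_nonneg _) (Real.exp_pos _).le
    have hae := h.ae_eq_zero_of_integral_obs hsupp hgc hsq hg0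
    refine h.eq_zero_of_forall_sub_dotProduct hsupp hvar ?_
    filter_upwards [hae] with ω hω t t'
    let x := X 0 ω
    have key : ∀ s : Fin T, ∑ j, (x s j - meanStat (unitOutcome t) x β₀ j) * v j = 0 := by
      intro s
      have h1 := hω (unitOutcome t)
      have h2 := (Finset.sum_eq_zero_iff_of_nonneg fun d _ =>
        mul_nonneg (sq_nonneg _) (Real.exp_pos _).le).1 h1 (unitOutcome s)
        (by simp [numOnes_unitOutcome])
      rw [mul_eq_zero, or_iff_left (Real.exp_pos _).ne'] at h2
      have h3 := pow_eq_zero_iff (two_ne_zero) |>.1 h2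
      simpa only [suffStat_unitOutcome] using h3
    have : ∑ l, (X 0 ω t l - X 0 ω t' l) * v l =
        ∑ j, (x t j - meanStat (unitOutcome t) x β₀ j) * v j -
          ∑ j, (x t' j - meanStat (unitOutcome t) x β₀ j) * v j := by
      rw [← Finset.sum_sub_distrib]
      exact Finset.sum_congr rfl fun l _ => by simp only [x]; ring
    rw [this, key, key, sub_zero]
  exact hlin

end Sample

/-! ### The expressions of the approximate average marginal effect -/

/-- The Chebyshev polynomial of degree `T + 1` has leading coefficient `2 ^ T`, and substituting `2u
- 1` contributes `2 ^ (T + 1)`; the two normalizing constants cancel exactly these. -/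
theorem natDegree_leadingCoeff_shiftedChebyshev (T : ℕ) :
    (shiftedChebyshev T).natDegree = T + 1 ∧ (shiftedChebyshev T).leadingCoeff = 1 := by
  have hq : (2 * Polynomial.X - 1 : Polynomial ℝ) = Polynomial.C 2 * Polynomial.X +
      Polynomial.C (-1) := by
    rw [map_neg, map_one, ← sub_eq_add_neg]
    rfl
  have hqd : (2 * Polynomial.X - 1 : Polynomial ℝ).natDegree = 1 := by
    rw [hq]; exact Polynomial.natDegree_linear two_ne_zero
  have hql : (2 * Polynomial.X - 1 : Polynomial ℝ).leadingCoeff = 2 := by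
    rw [hq]; exact Polynomial.leadingCoeff_linear two_ne_zero
  have hm : (monicChebyshev (T + 1)).natDegree = T + 1 := by
    rw [monicChebyshev, Polynomial.natDegree_C_mul (by positivity),
      Polynomial.Chebyshev.natDegree_T]
    exact Int.natAbs_natCast _
  have hml : (monicChebyshev (T + 1)).leadingCoeff = 1 := by
    rw [monicChebyshev, Polynomial.leadingCoeff_mul, Polynomial.leadingCoeff_C,
      Polynomial.Chebyshev.leadingCoeff_T, Int.natAbs_natCast]
    exact inv_mul_cancel₀ (by positivity)
  constructor
  · rw [shiftedChebyshev, Polynomial.natDegree_C_mul (by positivity), Polynomial.natDegree_comp,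
      hm, hqd, mul_one]
  · rw [shiftedChebyshev, Polynomial.leadingCoeff_mul, Polynomial.leadingCoeff_C,
      Polynomial.leadingCoeff_comp (by rw [hqd]; norm_num), hm, hml, hql, one_mul]
    exact inv_mul_cancel₀ (by positivity)

/-- Two monic polynomials of degree `T + 1` are subtracted, so the leading terms cancel. This is why
moments up to order `T` determine the integral. -/
theorem natDegree_bestApprox_lt (T : ℕ) : (bestApprox T).natDegree < T + 1 := by
  obtain ⟨hd, hl⟩ := natDegree_leadingCoeff_shiftedChebyshev T
  have hne : shiftedChebyshev T ≠ 0 := by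
    intro h; rw [h] at hl; simp at hl
  have hdeg : (bestApprox T).degree < (Polynomial.X ^ (T + 1) : Polynomial ℝ).degree := by
    refine Polynomial.degree_sub_lt_left ?_ (by simp) (by simp [hl])
    rw [Polynomial.degree_eq_natDegree hne, hd, Polynomial.degree_X_pow]
  rw [Polynomial.degree_X_pow] at hdeg
  rcases eq_or_ne (bestApprox T) 0 with h | h
  · simp [h]
  · exact (Polynomial.natDegree_lt_iff_degree_lt h).2 hdeg

theorem integral_bestApprox {T : ℕ} {ν : Measure ℝ} [IsProbabilityMeasure ν]
    (hν : ν (Set.Icc 0 1)ᶜ = 0) : ∫ u, (bestApprox T).eval u ∂ν =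
      ∑ t ∈ Finset.range (T + 1), (bestApprox T).coeff t * ∫ u, u ^ t ∂ν := by
  have hi : ∀ t : ℕ, Integrable (fun u : ℝ => u ^ t) ν := by
    intro t
    refine Integrable.of_bound (by fun_prop) 1 ?_
    have h : ∀ᵐ u ∂ν, u ∈ Set.Icc (0 : ℝ) 1 := hν
    filter_upwards [h] with u hu
    rw [Real.norm_of_nonneg (pow_nonneg hu.1 _)]
    exact pow_le_one₀ hu.1 hu.2
  simp only [Polynomial.eval_eq_sum_range' (natDegree_bestApprox_lt T)]
  rw [integral_finsetSum _ fun t _ => (hi t).const_mul _]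
  simp only [integral_const_mul]

section Sample

variable {Ω : Type*} [MeasurableSpace Ω] {P : Measure Ω} [IsProbabilityMeasure P] {T p : ℕ}
  [NeZero T] {X : ℕ → Ω → Covariates T p} {Y : ℕ → Ω → Outcomes T} {β₀ : Fin p → ℝ}
  {K : Set (Covariates T p × Outcomes T)}

/-- The variable whose conditional mean given `X` is `c_t(X)`. -/
noncomputable def cutWeight (t : ℕ) (w : Covariates T p × Outcomes T) (b : Fin p → ℝ) : ℝ :=
  if t ≤ numOnes w.2 then weight t (numOnes w.2) w.1 b else 0

theorem continuous_lam (t : ℕ) (b : Fin p → ℝ) : Continuous fun x : Covariates T p => lam t x b :=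
  continuous_obs_left (f := fun (x : Covariates T p) b => lam t x b) (contDiff_lam t).continuous b

theorem continuous_weight (t : ℕ) (y : Outcomes T) (b : Fin p → ℝ) :
    Continuous fun x : Covariates T p => weight t (numOnes y) x b :=
  continuous_obs_left (f := fun (x : Covariates T p) b => weight t (numOnes y) x b)
    (contDiff_weight t y).continuous b

theorem continuous_cutWeight (t : ℕ) (b : Fin p → ℝ) :
    Continuous fun w : Covariates T p × Outcomes T => cutWeight t w b := by
  refine continuous_prod_of_discrete_right.2 fun y => ?_
  by_cases h : t ≤ numOnes y
  · simpa only [cutWeight, h, if_true] using continuous_weight t y b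
  · simpa only [cutWeight, h, if_false] using continuous_const

theorem continuous_rFun (k : Fin p) (b : Fin p → ℝ) :
    Continuous fun w : Covariates T p × Outcomes T => rFun k w.1 (numOnes w.2) b := by
  refine continuous_prod_of_discrete_right.2 fun y => ?_
  unfold rFun
  have h : ∀ t, Continuous fun x : Covariates T p => lam t x b * weight t (numOnes y) x b :=
    fun t => (continuous_lam t b).mul (continuous_weight t y b)
  exact continuous_const.mul (continuous_finsetSum (Finset.range (numOnes y + 1)) fun t _ => h t)

/-- Cutting the weights to zero for `t > S` replaces the random range of summation by a fixed one,
so that expectations can be taken term by term. -/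
theorem mul_pFun_eq (k : Fin p) (w : Covariates T p × Outcomes T) (b : Fin p → ℝ) :
    b k * pFun w.1 (numOnes w.2) b = rFun k w.1 (numOnes w.2) b +
      b k * ∑ t ∈ Finset.range (T + 1),
        (bestApprox T).coeff t * (lam (T + 1) w.1 b * cutWeight t w b) := by
  have hs : ∑ t ∈ Finset.range (T + 1),
        (bestApprox T).coeff t * (lam (T + 1) w.1 b * cutWeight t w b) =
      ∑ t ∈ Finset.range (numOnes w.2 + 1),
        (bestApprox T).coeff t * (lam (T + 1) w.1 b * weight t (numOnes w.2) w.1 b) := by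
    have hsub : Finset.range (numOnes w.2 + 1) ⊆ Finset.range (T + 1) :=
      Finset.range_mono (Nat.succ_le_succ (numOnes_le w.2))
    rw [← Finset.sum_subset hsub]
    · refine Finset.sum_congr rfl fun t ht => ?_
      rw [cutWeight, if_pos (Nat.lt_succ_iff.1 (Finset.mem_range.1 ht))]
    · intro t _ ht
      rw [cutWeight, if_neg fun h => ht (Finset.mem_range.2 (Nat.lt_succ_iff.2 h)), mul_zero,
        mul_zero]
  rw [hs, rFun, pFun, ← mul_add, ← Finset.sum_add_distrib]
  congr 1
  exact Finset.sum_congr rfl fun t _ => by ring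

/-- A function of `X` can be moved inside the conditional expectation given `X`, and the tower
property removes the conditioning. -/
theorem integral_mul_cX (hW : IsCompactIID P (fun i ω => (X i ω, Y i ω)) K) {L : Covariates T p → ℝ}
    (hL : Continuous L) (t : ℕ) :
    Integrable (fun ω => L (X 0 ω) * cX P (X 0) (Y 0) β₀ t ω) P ∧
      ∫ ω, L (X 0 ω) * cX P (X 0) (Y 0) β₀ t ω ∂P =
        ∫ ω, L (X 0 ω) * cutWeight t (X 0 ω, Y 0 ω) β₀ ∂P := by
  have hX : Measurable (X 0) := measurable_fst.comp (hW.measurable 0)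
  have hc := continuous_cutWeight (T := T) t β₀
  have hi : Integrable (fun ω => cutWeight t (X 0 ω, Y 0 ω) β₀) P := hW.integrable_comp hc
  have hLi : Integrable ((fun ω => L (X 0 ω)) * fun ω => cutWeight t (X 0 ω, Y 0 ω) β₀) P :=
    hW.integrable_comp (g := fun w => L w.1 * cutWeight t w β₀) ((hL.comp continuous_fst).mul hc)
  have hLm : StronglyMeasurable[MeasurableSpace.comap (X 0) inferInstance] fun ω => L (X 0 ω) :=
    (hL.measurable.comp (comap_measurable (X 0))).stronglyMeasurable
  have hpull := condExp_mul_of_stronglyMeasurable_left hLm hLi hi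
  have hpull' : P[(fun ω => L (X 0 ω)) * fun ω => cutWeight t (X 0 ω, Y 0 ω) β₀ |
      MeasurableSpace.comap (X 0) inferInstance] =ᵐ[P]
      fun ω => L (X 0 ω) * cX P (X 0) (Y 0) β₀ t ω := hpull
  refine ⟨integrable_condExp.congr hpull', ?_⟩
  rw [← integral_congr_ae hpull', integral_condExp hX.comap_le]
  rfl

/-- For `t = 0` the weight is positive and never cut, so it is bounded below on the compact set, and
conditional expectation preserves the bound. This allows division by `c_0(X)` in the moment
conditions. -/
theorem cX_zero_pos (hW : IsCompactIID P (fun i ω => (X i ω, Y i ω)) K) :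
    ∀ᵐ ω ∂P, 0 < cX P (X 0) (Y 0) β₀ 0 ω := by
  have hX : Measurable (X 0) := measurable_fst.comp (hW.measurable 0)
  have hc := continuous_cutWeight (T := T) 0 β₀
  have hi : Integrable (fun ω => cutWeight 0 (X 0 ω, Y 0 ω) β₀) P := hW.integrable_comp hc
  have hpos : ∀ w : Covariates T p × Outcomes T, 0 < cutWeight 0 w β₀ := by
    intro w
    rw [cutWeight, if_pos (Nat.zero_le _), weight]
    refine div_pos (mul_pos ?_ (Real.exp_pos _)) (condC_pos _ _ _)
    exact_mod_cast Nat.choose_pos (by simpa using numOnes_le w.2)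
  obtain ⟨c, hc0, hcK⟩ : ∃ c > 0, ∀ w ∈ K, c ≤ cutWeight 0 w β₀ := by
    rcases K.eq_empty_or_nonempty with h | h
    · exact ⟨1, one_pos, by simp [h]⟩
    · obtain ⟨w, -, hw⟩ := hW.compact.exists_isMinOn h hc.continuousOn
      exact ⟨_, hpos w, fun v hv => hw hv⟩
  have hmono := condExp_mono (m := MeasurableSpace.comap (X 0) inferInstance)
    (integrable_const c) hi (hW.mem.mono fun ω hω => hcK _ hω)
  rw [condExp_const hX.comap_le] at hmono
  filter_upwards [hmono] with ω hω
  exact hc0.trans_le hω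

theorem deltaTilde_eq (hW : IsCompactIID P (fun i ω => (X i ω, Y i ω)) K) (k : Fin p) :
    deltaTilde P (X 0) (Y 0) β₀ k = β₀ k * ∫ ω, pFun (X 0 ω) (numOnes (Y 0 ω)) β₀ ∂P := by
  have hr : Integrable (fun ω => rFun k (X 0 ω) (numOnes (Y 0 ω)) β₀) P :=
    hW.integrable_comp (continuous_rFun k β₀)
  have hL := continuous_lam (T := T) (T + 1) β₀
  have hc := fun t => integral_mul_cX (β₀ := β₀) hW hL t
  have hw : ∀ t, Integrable (fun ω => lam (T + 1) (X 0 ω) β₀ * cutWeight t (X 0 ω, Y 0 ω) β₀) P :=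
    fun t => hW.integrable_comp (g := fun w => lam (T + 1) w.1 β₀ * cutWeight t w β₀)
      ((hL.comp continuous_fst).mul (continuous_cutWeight t β₀))
  have h1 : ∀ ω, rFun k (X 0 ω) (numOnes (Y 0 ω)) β₀ + β₀ k * lam (T + 1) (X 0 ω) β₀ *
      ∑ t ∈ Finset.range (T + 1), (bestApprox T).coeff t * cX P (X 0) (Y 0) β₀ t ω =
      rFun k (X 0 ω) (numOnes (Y 0 ω)) β₀ + β₀ k * ∑ t ∈ Finset.range (T + 1),
        (bestApprox T).coeff t * (lam (T + 1) (X 0 ω) β₀ * cX P (X 0) (Y 0) β₀ t ω) := by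
    intro ω
    rw [mul_assoc, Finset.mul_sum]
    congr 2
    exact Finset.sum_congr rfl fun t _ => by ring
  simp only [deltaTilde, h1]
  rw [integral_add hr ((integrable_finsetSum _ fun t _ => (hc t).1.const_mul _).const_mul _),
    integral_const_mul, integral_finsetSum _ fun t _ => (hc t).1.const_mul _]
  simp only [integral_const_mul, (hc _).2]
  rw [← integral_const_mul]
  simp only [mul_pFun_eq k (X 0 _, Y 0 _) β₀]
  rw [integral_add hr ((integrable_finsetSum _ fun t _ => (hw t).const_mul _).const_mul _),
    integral_const_mul, integral_finsetSum _ fun t _ => (hw t).const_mul _]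
  simp only [integral_const_mul]

theorem deltaTilde_eq_moment (hW : IsCompactIID P (fun i ω => (X i ω, Y i ω)) K) (k : Fin p)
    {μ : Covariates T p → Measure ℝ} (hμ : IsMomentFamily P (X 0) (Y 0) β₀ μ) :
    deltaTilde P (X 0) (Y 0) β₀ k =
      ∫ ω, (rFun k (X 0 ω) (numOnes (Y 0 ω)) β₀ +
        β₀ k * cX P (X 0) (Y 0) β₀ 0 ω * lam (T + 1) (X 0 ω) β₀ *
          ∫ u, (bestApprox T).eval u ∂(μ (X 0 ω))) ∂P := by
  refine integral_congr_ae ?_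
  filter_upwards [hμ, cX_zero_pos (β₀ := β₀) hW] with ω ⟨hp, hs, hm⟩ hpos
  have h1 : ∑ t ∈ Finset.range (T + 1), (bestApprox T).coeff t * cX P (X 0) (Y 0) β₀ t ω =
      cX P (X 0) (Y 0) β₀ 0 ω * ∫ u, (bestApprox T).eval u ∂(μ (X 0 ω)) := by
    rw [integral_bestApprox hs, Finset.mul_sum]
    refine Finset.sum_congr rfl fun t ht => ?_
    rw [hm t (Nat.lt_succ_iff.1 (Finset.mem_range.1 ht))]
    field_simp
  rw [h1]
  ring

end Sample

/-! ### Matrix inverses -/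

/-- Cramer's formula also holds for singular matrices, where both sides are zero. It gives
measurability of the inverse everywhere, and continuity where the determinant is nonzero. -/
theorem inv_apply_eq {p : ℕ} (M : Matrix (Fin p) (Fin p) ℝ) (j l : Fin p) :
    M⁻¹ j l = M.det⁻¹ * M.adjugate j l := by
  rw [Matrix.inv_def, Ring.inverse_eq_inv', Matrix.smul_apply, smul_eq_mul]

theorem continuous_det_of {p : ℕ} :
    Continuous fun M : Fin p → Fin p → ℝ => (Matrix.of M).det :=
  Continuous.matrix_det continuous_id

theorem continuous_adjugate_of {p : ℕ} (j l : Fin p) :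
    Continuous fun M : Fin p → Fin p → ℝ => (Matrix.of M).adjugate j l :=
  (Continuous.matrix_adjugate continuous_id).matrix_elem j l

theorem measurable_inv_of {p : ℕ} (j l : Fin p) :
    Measurable fun M : Fin p → Fin p → ℝ => (Matrix.of M)⁻¹ j l := by
  simp only [inv_apply_eq]
  exact continuous_det_of.measurable.inv.mul (continuous_adjugate_of j l).measurable

theorem tendsto_inv_apply {p : ℕ} {M : ℕ → Matrix (Fin p) (Fin p) ℝ}
    {M₀ : Matrix (Fin p) (Fin p) ℝ} (h0 : IsUnit M₀)
    (hM : ∀ j l, Tendsto (fun n => M n j l) atTop (𝓝 (M₀ j l))) :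
    (∀ᶠ n in atTop, IsUnit (M n).det) ∧
      ∀ j l, Tendsto (fun n => (M n)⁻¹ j l) atTop (𝓝 (M₀⁻¹ j l)) := by
  have hdet : M₀.det ≠ 0 := ((Matrix.isUnit_iff_isUnit_det _).1 h0).ne_zero
  have hlim : Tendsto (fun n => (fun j l => M n j l : Fin p → Fin p → ℝ)) atTop
      (𝓝 fun j l => M₀ j l) := tendsto_pi_nhds.2 fun j => tendsto_pi_nhds.2 fun l => hM j l
  have hd : Tendsto (fun n => (M n).det) atTop (𝓝 M₀.det) :=
    (continuous_det_of.tendsto _).comp hlim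
  refine ⟨(hd.eventually_ne hdet).mono fun n hn => hn.isUnit, fun j l => ?_⟩
  simp only [inv_apply_eq]
  exact (hd.inv₀ hdet).mul (((continuous_adjugate_of j l).tendsto _).comp hlim)

/-! ### The influence function -/

/-- The estimation error minus the normalized sum of the influence functions, as a linear
combination of the normalized scores. -/
theorem expansion_eq {p n : ℕ} (hn : 0 < n) (k : Fin p) {s : ℕ → Fin p → ℝ} {q : ℕ → ℝ}
    {d G v : Fin p → ℝ} {M J : Matrix (Fin p) (Fin p) ℝ} (hM : IsUnit M.det) {b m pbar : ℝ}
    (hs : ∀ j, (1 / (n : ℝ)) * ∑ i ∈ Finset.range n, s i j = M.mulVec d j)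
    (hp : pbar - (1 / (n : ℝ)) * ∑ i ∈ Finset.range n, q i = ∑ l, G l * d l) :
    √(n : ℝ) * ((b + d k) * pbar - b * m) - (1 / √(n : ℝ)) * ∑ i ∈ Finset.range n,
        (m * J.mulVec (s i) k + b * (q i - m + v ⬝ᵥ J.mulVec (s i))) =
      ∑ j, (pbar * M⁻¹ k j - m * J k j + b * (∑ l, G l * M⁻¹ l j - ∑ l, v l * J l j)) *
        ((1 / √(n : ℝ)) * ∑ i ∈ Finset.range n, s i j) := by
  have hn' : (0 : ℝ) < n := by exact_mod_cast hn
  have hsq : √(n : ℝ) * √(n : ℝ) = n := Real.mul_self_sqrt hn'.le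
  have hr : 0 < √(n : ℝ) := Real.sqrt_pos.2 hn'
  have hinv : 1 / √(n : ℝ) = √(n : ℝ) * (1 / n) := by
    rw [mul_one_div, div_eq_div_iff hr.ne' hn'.ne', one_mul, hsq]
  set z : Fin p → ℝ := fun j => (1 / √(n : ℝ)) * ∑ i ∈ Finset.range n, s i j with hz
  -- This is the normalized score equation; inverting `M` expresses the scaled estimation error
  -- through the scores alone.
  have hzM : z = M.mulVec (√(n : ℝ) • d) := by
    ext j
    rw [Matrix.mulVec_smul, Pi.smul_apply, smul_eq_mul, ← hs j, ← mul_assoc, ← hinv]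
  have hd : ∀ l, √(n : ℝ) * d l = ∑ j, M⁻¹ l j * z j := by
    intro l
    have : M⁻¹.mulVec z = √(n : ℝ) • d := by
      rw [hzM, Matrix.mulVec_mulVec, Matrix.nonsing_inv_mul _ hM, Matrix.one_mulVec]
    have := congrFun this l
    rw [Pi.smul_apply, smul_eq_mul] at this
    rw [← this]
    rfl
  have hJ : ∀ l, (1 / √(n : ℝ)) * ∑ i ∈ Finset.range n, J.mulVec (s i) l = ∑ j, J l j * z j := by
    intro l
    simp only [Matrix.mulVec, dotProduct, hz, Finset.mul_sum]
    rw [Finset.sum_comm]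
    exact Finset.sum_congr rfl fun j _ => Finset.sum_congr rfl fun i _ => by ring
  have hsum : (1 / √(n : ℝ)) * ∑ i ∈ Finset.range n,
        (m * J.mulVec (s i) k + b * (q i - m + v ⬝ᵥ J.mulVec (s i))) =
      m * (∑ j, J k j * z j) + b * (√(n : ℝ) * ((1 / (n : ℝ)) * ∑ i ∈ Finset.range n, q i - m) +
        ∑ l, v l * ∑ j, J l j * z j) := by
    have h1 : ∑ i ∈ Finset.range n, v ⬝ᵥ J.mulVec (s i) =
        ∑ l, v l * ∑ i ∈ Finset.range n, J.mulVec (s i) l := by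
      simp only [dotProduct, Finset.mul_sum]
      exact Finset.sum_comm
    have h2 : (1 / √(n : ℝ)) * ∑ l, v l * ∑ i ∈ Finset.range n, J.mulVec (s i) l =
        ∑ l, v l * ∑ j, J l j * z j := by
      rw [Finset.mul_sum]
      refine Finset.sum_congr rfl fun l _ => ?_
      rw [← hJ]; ring
    have h3 : (1 / √(n : ℝ)) * (n * m) = √(n : ℝ) * m := by
      rw [hinv]; field_simp
    simp only [Finset.sum_add_distrib, Finset.sum_sub_distrib, ← Finset.mul_sum, Finset.sum_const,
      Finset.card_range, nsmul_eq_mul, h1, mul_add, mul_sub]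
    rw [← h2, ← hJ k, ← h3]
    rw [show √(n : ℝ) * (1 / (n : ℝ) * ∑ i ∈ Finset.range n, q i) =
      1 / √(n : ℝ) * ∑ i ∈ Finset.range n, q i by rw [hinv]; ring]
    ring
  have hG : √(n : ℝ) * (pbar - (1 / (n : ℝ)) * ∑ i ∈ Finset.range n, q i) =
      ∑ l, G l * ∑ j, M⁻¹ l j * z j := by
    rw [hp, Finset.mul_sum]
    refine Finset.sum_congr rfl fun l _ => ?_
    rw [← hd]; ring
  have hswap : ∀ (a : Fin p → ℝ) (A : Matrix (Fin p) (Fin p) ℝ),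
      ∑ l, a l * ∑ j, A l j * z j = ∑ j, (∑ l, a l * A l j) * z j := by
    intro a A
    simp only [Finset.mul_sum, Finset.sum_mul]
    rw [Finset.sum_comm]
    exact Finset.sum_congr rfl fun j _ => Finset.sum_congr rfl fun l _ => by ring
  have hrhs : ∑ j, (pbar * M⁻¹ k j - m * J k j + b * (∑ l, G l * M⁻¹ l j - ∑ l, v l * J l j)) *
      z j = pbar * (∑ j, M⁻¹ k j * z j) - m * (∑ j, J k j * z j) +
        b * (∑ l, G l * ∑ j, M⁻¹ l j * z j - ∑ l, v l * ∑ j, J l j * z j) := by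
    rw [hswap, hswap, Finset.mul_sum, Finset.mul_sum, ← Finset.sum_sub_distrib,
      ← Finset.sum_sub_distrib, Finset.mul_sum, ← Finset.sum_add_distrib]
    exact Finset.sum_congr rfl fun j _ => by ring
  rw [hsum, hrhs, ← hd k, ← hG]
  ring

/-- The influence function of the estimator as a function of the observation and of the unknown
quantities on which it depends. -/
noncomputable def influence {T p : ℕ} [NeZero T] (k : Fin p) (w : Covariates T p × Outcomes T)
    (θ : (Fin p → ℝ) × ℝ × (Fin p → ℝ) × (Fin p → Fin p → ℝ)) : ℝ :=
  θ.2.1 * (Matrix.of θ.2.2.2).mulVec (grad (condLogLik w.2 w.1) θ.1) k +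
    θ.1 k * (pFun w.1 (numOnes w.2) θ.1 - θ.2.1 +
      θ.2.2.1 ⬝ᵥ (Matrix.of θ.2.2.2).mulVec (grad (condLogLik w.2 w.1) θ.1))

/-! ### Joint continuity in the observation and the parameters -/

section Continuity

variable {T p : ℕ} [NeZero T]

theorem continuous_pFun : Continuous (Function.uncurry
    fun (w : Covariates T p × Outcomes T) b => pFun w.1 (numOnes w.2) b) :=
  continuous_uncurry_obs (f := fun x y b => pFun x (numOnes y) b) fun y =>
    (contDiff_pFun y).continuous

theorem continuous_grad_pFun (j : Fin p) : Continuous (Function.uncurry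
    fun (w : Covariates T p × Outcomes T) b => grad (pFun w.1 (numOnes w.2)) b j) :=
  continuous_uncurry_obs (f := fun x y b => grad (pFun x (numOnes y)) b j) fun y =>
    (contDiff_grad (contDiff_pFun y) j).continuous

theorem continuous_comp_uncurry {A B Z : Type*} [TopologicalSpace A] [TopologicalSpace B]
    [TopologicalSpace Z] {f : A → B → ℝ} (hf : Continuous (Function.uncurry f)) {a : Z → A}
    {b : Z → B} (ha : Continuous a) (hb : Continuous b) : Continuous fun z => f (a z) (b z) :=
  hf.comp (ha.prodMk hb)

theorem continuous_influence (k : Fin p) :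
    Continuous (Function.uncurry (influence (T := T) (p := p) k)) := by
  have hs : ∀ j, Continuous fun z : (Covariates T p × Outcomes T) ×
      ((Fin p → ℝ) × ℝ × (Fin p → ℝ) × (Fin p → Fin p → ℝ)) =>
      grad (condLogLik z.1.2 z.1.1) z.2.1 j := fun j =>
    continuous_comp_uncurry
      (f := fun (w : Covariates T p × Outcomes T) b => grad (condLogLik w.2 w.1) b j)
      (continuous_grad_condLogLik j) continuous_fst (continuous_fst.comp continuous_snd)
  have hp : Continuous fun z : (Covariates T p × Outcomes T) ×
      ((Fin p → ℝ) × ℝ × (Fin p → ℝ) × (Fin p → Fin p → ℝ)) =>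
      pFun z.1.1 (numOnes z.1.2) z.2.1 :=
    continuous_comp_uncurry
      (f := fun (w : Covariates T p × Outcomes T) b => pFun w.1 (numOnes w.2) b)
      continuous_pFun continuous_fst (continuous_fst.comp continuous_snd)
  unfold Function.uncurry influence Matrix.mulVec dotProduct
  simp only [Matrix.of_apply]
  fun_prop

end Continuity

/-! ### Consistency, linearization and variance estimation -/

section Asymptotics

variable {Ω : Type*} [MeasurableSpace Ω] {P : Measure Ω} [IsProbabilityMeasure P] {T p : ℕ}
  [NeZero T] {X : ℕ → Ω → Covariates T p} {α : ℕ → Ω → ℝ} {ε : ℕ → Ω → Fin T → ℝ}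
  {Y : ℕ → Ω → Outcomes T} {β₀ : Fin p → ℝ} {K : Set (Covariates T p × Outcomes T)}
  {Θ : Set (Fin p → ℝ)} {βhat : ℕ → Ω → Fin p → ℝ}

omit [NeZero T] in
/-- Strong consistency of the conditional maximum likelihood estimator, and its first order
condition. -/
theorem IsSample.tendsto_cmle (h : IsSample P X α ε Y β₀)
    (hsupp : IsCompact (P.map (X 0)).support) (hvar : IsUnit (variationMatrix P (X 0)))
    (hΘ : β₀ ∈ interior Θ) (hβ : IsCMLE P X Y Θ βhat) :
    ∀ᵐ ω ∂P, Tendsto (fun n => βhat n ω) atTop (𝓝 β₀) ∧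
      ∀ᶠ n in atTop, ∀ j, ∑ i ∈ Finset.range n,
        grad (condLogLik (Y i ω) (X i ω)) (βhat n ω) j = 0 := by
  have hmain := (h.isCompactIID hsupp).tendsto_argmax
    (f := fun (w : Covariates T p × Outcomes T) b => condLogLik w.2 w.1 b)
    continuous_condLogLik_obs (fun w => concaveOn_condLogLik w.2 w.1)
    (fun b hb => h.integral_condLogLik_lt hsupp hvar hb) hΘ (fun n => (hβ n).2)
  filter_upwards [hmain] with ω ⟨hlim, hmax⟩
  refine ⟨hlim, ?_⟩
  -- Consistency eventually places the maximizer in the interior of `Θ`, where the gradient must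
  -- vanish.
  filter_upwards [hmax, hlim.eventually (isOpen_interior.mem_nhds hΘ)] with n hn hin j
  have hloc : IsLocalMax (fun b => ∑ i ∈ Finset.range n, condLogLik (Y i ω) (X i ω) b)
      (βhat n ω) := hn.isLocalMax (mem_interior_iff_mem_nhds.1 hin)
  have h0 := hloc.fderiv_eq_zero
  rw [fderiv_fun_sum fun i _ => differentiable_condLogLik (Y i ω) (X i ω) _] at h0
  have := DFunLike.congr_fun h0 (Pi.single j 1)
  rwa [sum_apply] at this

theorem tendsto_pMean (hW : IsCompactIID P (fun i ω => (X i ω, Y i ω)) K)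
    (hβ : ∀ᵐ ω ∂P, Tendsto (fun n => βhat n ω) atTop (𝓝 β₀)) :
    ∀ᵐ ω ∂P, Tendsto (fun n => pMean X Y βhat n ω) atTop
      (𝓝 (∫ ω, pFun (X 0 ω) (numOnes (Y 0 ω)) β₀ ∂P)) :=
  hW.tendsto_mean_comp (g := fun (w : Covariates T p × Outcomes T) b => pFun w.1 (numOnes w.2) b)
    continuous_pFun hβ

theorem tendsto_pGradMean (hW : IsCompactIID P (fun i ω => (X i ω, Y i ω)) K)
    (hβ : ∀ᵐ ω ∂P, Tendsto (fun n => βhat n ω) atTop (𝓝 β₀)) :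
    ∀ᵐ ω ∂P, ∀ j, Tendsto (fun n => pGradMean X Y βhat n ω j) atTop
      (𝓝 (∫ ω, grad (pFun (X 0 ω) (numOnes (Y 0 ω))) β₀ j ∂P)) :=
  ae_all_iff.2 fun j => hW.tendsto_mean_comp
    (g := fun (w : Covariates T p × Outcomes T) b => grad (pFun w.1 (numOnes w.2)) b j)
    (continuous_grad_pFun j) hβ

omit [NeZero T] in
theorem tendsto_informationHat (hW : IsCompactIID P (fun i ω => (X i ω, Y i ω)) K)
    (hβ : ∀ᵐ ω ∂P, Tendsto (fun n => βhat n ω) atTop (𝓝 β₀)) :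
    ∀ᵐ ω ∂P, ∀ j l, Tendsto (fun n => informationHat X Y βhat n ω j l) atTop
      (𝓝 (information P (X 0) (Y 0) β₀ j l)) := by
  refine ae_all_iff.2 fun j => ae_all_iff.2 fun l => ?_
  have h := hW.tendsto_mean_comp
    (g := fun (w : Covariates T p × Outcomes T) b => hess (condLogLik w.2 w.1) b j l)
    (continuous_hess_condLogLik j l) hβ
  filter_upwards [h] with ω hω
  exact hω.neg

omit [NeZero T] in
theorem continuous_slopeFun_score (j l : Fin p) : Continuous (Function.uncurry
    fun (w : Covariates T p × Outcomes T) b =>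
      slopeFun (fun b => grad (condLogLik w.2 w.1) b j) β₀ b l) :=
  continuous_uncurry_obs (f := fun x y b => slopeFun (fun b => grad (condLogLik y x) b j) β₀ b l)
    fun y => continuous_slopeFun (contDiff_grad (contDiff_condLogLik y) j) β₀ l

theorem continuous_slopeFun_pFun (l : Fin p) : Continuous (Function.uncurry
    fun (w : Covariates T p × Outcomes T) b => slopeFun (pFun w.1 (numOnes w.2)) β₀ b l) :=
  continuous_uncurry_obs (f := fun x y b => slopeFun (pFun x (numOnes y)) β₀ b l)
    fun y => continuous_slopeFun (contDiff_pFun y) β₀ l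

/-- The population arguments of the influence function. -/
noncomputable def influenceArg (P : Measure Ω) (X : ℕ → Ω → Covariates T p)
    (Y : ℕ → Ω → Outcomes T) (β₀ : Fin p → ℝ) :
    (Fin p → ℝ) × ℝ × (Fin p → ℝ) × (Fin p → Fin p → ℝ) :=
  (β₀, ∫ ω', pFun (X 0 ω') (numOnes (Y 0 ω')) β₀ ∂P,
    fun j => ∫ ω', grad (pFun (X 0 ω') (numOnes (Y 0 ω'))) β₀ j ∂P,
    fun j l => (information P (X 0) (Y 0) β₀)⁻¹ j l)

/-- The estimated arguments of the influence function. -/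
noncomputable def influenceArgHat (X : ℕ → Ω → Covariates T p) (Y : ℕ → Ω → Outcomes T)
    (βhat : ℕ → Ω → Fin p → ℝ) (n : ℕ) (ω : Ω) :
    (Fin p → ℝ) × ℝ × (Fin p → ℝ) × (Fin p → Fin p → ℝ) :=
  (βhat n ω, pMean X Y βhat n ω, pGradMean X Y βhat n ω,
    fun j l => (informationHat X Y βhat n ω)⁻¹ j l)

omit [IsProbabilityMeasure P] in
theorem psi_eq (k : Fin p) (i : ℕ) : psi P X Y β₀ k i =
    (fun w => influence k w (influenceArg P X Y β₀)) ∘ fun ω => (X i ω, Y i ω) := rfl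

omit [MeasurableSpace Ω] in
theorem psiHat_eq (k : Fin p) (n i : ℕ) (ω : Ω) : psiHat X Y βhat k n i ω =
    influence k (X i ω, Y i ω) (influenceArgHat X Y βhat n ω) := rfl

theorem continuous_influence_left (k : Fin p)
    (θ : (Fin p → ℝ) × ℝ × (Fin p → ℝ) × (Fin p → Fin p → ℝ)) :
    Continuous fun w : Covariates T p × Outcomes T => influence k w θ :=
  continuous_obs_left (f := influence (T := T) k) (continuous_influence k) θ

omit [NeZero T] in
theorem continuous_score_left (b : Fin p → ℝ) (j : Fin p) :
    Continuous fun w : Covariates T p × Outcomes T => grad (condLogLik w.2 w.1) b j :=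
  continuous_obs_left (f := fun (w : Covariates T p × Outcomes T) b =>
    grad (condLogLik w.2 w.1) b j) (continuous_grad_condLogLik j) b

/-- The score is centered, hence so is `phi`, and `p` enters in deviation from its mean. Centering
removes the recentering term in the central limit theorem and makes the variance a second moment. -/
theorem IsSample.integral_psi (h : IsSample P X α ε Y β₀)
    (hsupp : IsCompact (P.map (X 0)).support) (k : Fin p) :
    ∫ ω, psi P X Y β₀ k 0 ω ∂P = 0 := by
  have hW := h.isCompactIID hsupp
  have hs : ∀ j, Integrable (fun ω => grad (condLogLik (Y 0 ω) (X 0 ω)) β₀ j) P := fun j =>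
    hW.integrable_comp (continuous_score_left (T := T) β₀ j)
  have hp : Integrable (fun ω => pFun (X 0 ω) (numOnes (Y 0 ω)) β₀) P :=
    hW.integrable_comp (continuous_obs_left
      (f := fun (w : Covariates T p × Outcomes T) b => pFun w.1 (numOnes w.2) b)
      continuous_pFun β₀)
  have hφi : ∀ l, Integrable (fun ω => phi P X Y β₀ 0 ω l) P := fun l =>
    integrable_finsetSum (f := fun j ω => (information P (X 0) (Y 0) β₀)⁻¹ l j *
      grad (condLogLik (Y 0 ω) (X 0 ω)) β₀ j) Finset.univ fun j _ => (hs j).const_mul _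
  have hφ : ∀ l, ∫ ω, phi P X Y β₀ 0 ω l ∂P = 0 := by
    intro l
    simp only [phi, Matrix.mulVec, dotProduct]
    rw [integral_finsetSum _ fun j _ => (hs j).const_mul _]
    simp only [integral_const_mul, h.integral_score hsupp, mul_zero, Finset.sum_const_zero]
  set m := ∫ ω', pFun (X 0 ω') (numOnes (Y 0 ω')) β₀ ∂P with hm
  simp only [psi, dotProduct]
  rw [← hm]
  have hvi : Integrable (fun ω => ∑ l, (∫ ω', grad (pFun (X 0 ω') (numOnes (Y 0 ω'))) β₀ l ∂P) *
      phi P X Y β₀ 0 ω l) P := integrable_finsetSum _ fun l _ => (hφi l).const_mul _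
  have hpm : Integrable (fun ω => pFun (X 0 ω) (numOnes (Y 0 ω)) β₀ - m) P :=
    hp.sub (integrable_const m)
  have hadd : Integrable (fun ω => pFun (X 0 ω) (numOnes (Y 0 ω)) β₀ - m +
      ∑ l, (∫ ω', grad (pFun (X 0 ω') (numOnes (Y 0 ω'))) β₀ l ∂P) * phi P X Y β₀ 0 ω l) P :=
    hpm.add hvi
  rw [integral_add ((hφi k).const_mul m) (hadd.const_mul (β₀ k)), integral_const_mul,
    integral_const_mul, hφ, integral_add hpm hvi, integral_sub hp (integrable_const m),
    integral_finsetSum _ fun l _ => (hφi l).const_mul _]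
  simp only [integral_const_mul, hφ, integral_const, probReal_univ, one_smul, ← hm]
  simp

omit [IsProbabilityMeasure P] [NeZero T] in
/-- Measurability of functions of the observation evaluated at an estimator. -/
theorem aemeasurable_obs_comp {E : Type*} [TopologicalSpace E] [SecondCountableTopology E]
    [MeasurableSpace E] [OpensMeasurableSpace E]
    (hW : IsCompactIID P (fun i ω => (X i ω, Y i ω)) K)
    {g : Covariates T p × Outcomes T → E → ℝ} (hg : Continuous (Function.uncurry g))
    {θ : Ω → E} (hθ : AEMeasurable θ P) (i : ℕ) :
    AEMeasurable (fun ω => g (X i ω, Y i ω) (θ ω)) P :=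
  hg.measurable.comp_aemeasurable ((hW.measurable i).aemeasurable.prodMk hθ)

omit [IsProbabilityMeasure P] [NeZero T] in
theorem aemeasurable_mean_comp {E : Type*} [TopologicalSpace E] [SecondCountableTopology E]
    [MeasurableSpace E] [OpensMeasurableSpace E]
    (hW : IsCompactIID P (fun i ω => (X i ω, Y i ω)) K)
    {g : Covariates T p × Outcomes T → E → ℝ} (hg : Continuous (Function.uncurry g))
    {θ : Ω → E} (hθ : AEMeasurable θ P) (n : ℕ) :
    AEMeasurable (fun ω => (1 / (n : ℝ)) * ∑ i ∈ Finset.range n, g (X i ω, Y i ω) (θ ω)) P :=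
  (Finset.aemeasurable_fun_sum _ fun i _ => aemeasurable_obs_comp hW hg hθ i).const_mul _

omit [IsProbabilityMeasure P] in
theorem aemeasurable_pMean (hW : IsCompactIID P (fun i ω => (X i ω, Y i ω)) K) {n : ℕ}
    (hβ : AEMeasurable (βhat n) P) : AEMeasurable (pMean X Y βhat n) P :=
  aemeasurable_mean_comp hW
    (g := fun (w : Covariates T p × Outcomes T) b => pFun w.1 (numOnes w.2) b)
    continuous_pFun hβ n

omit [IsProbabilityMeasure P] in
theorem aemeasurable_deltaHat (hW : IsCompactIID P (fun i ω => (X i ω, Y i ω)) K) {n : ℕ}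
    (hβ : AEMeasurable (βhat n) P) (k : Fin p) : AEMeasurable (deltaHat X Y βhat k n) P :=
  ((measurable_pi_apply k).comp_aemeasurable hβ).mul (aemeasurable_pMean hW hβ)

omit [IsProbabilityMeasure P] in
theorem aemeasurable_influenceArgHat (hW : IsCompactIID P (fun i ω => (X i ω, Y i ω)) K) {n : ℕ}
    (hβ : AEMeasurable (βhat n) P) : AEMeasurable (influenceArgHat X Y βhat n) P := by
  have hG : AEMeasurable (pGradMean X Y βhat n) P := aemeasurable_pi_lambda _ fun j =>
    aemeasurable_mean_comp hW
      (g := fun (w : Covariates T p × Outcomes T) b => grad (pFun w.1 (numOnes w.2)) b j)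
      (continuous_grad_pFun j) hβ n
  have hI : AEMeasurable (fun ω => (fun j l => informationHat X Y βhat n ω j l :
      Fin p → Fin p → ℝ)) P := aemeasurable_pi_lambda _ fun j => aemeasurable_pi_lambda _ fun l =>
    (aemeasurable_mean_comp hW
      (g := fun (w : Covariates T p × Outcomes T) b => hess (condLogLik w.2 w.1) b j l)
      (continuous_hess_condLogLik j l) hβ n).neg
  have hJ : AEMeasurable (fun ω => (fun j l => (informationHat X Y βhat n ω)⁻¹ j l :
      Fin p → Fin p → ℝ)) P := aemeasurable_pi_lambda _ fun j => aemeasurable_pi_lambda _ fun l =>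
    (measurable_inv_of j l).comp_aemeasurable hI
  exact hβ.prodMk ((aemeasurable_pMean hW hβ).prodMk (hG.prodMk hJ))

/-- Consistency of the estimator of the asymptotic standard deviation. -/
theorem IsSample.tendstoInMeasure_sigmaHat (h : IsSample P X α ε Y β₀)
    (hsupp : IsCompact (P.map (X 0)).support) (hvar : IsUnit (variationMatrix P (X 0)))
    (hβm : ∀ n, AEMeasurable (βhat n) P)
    (hβ : ∀ᵐ ω ∂P, Tendsto (fun n => βhat n ω) atTop (𝓝 β₀)) (k : Fin p) :
    TendstoInMeasure P (fun n => sigmaHat X Y βhat k n) atTop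
      (fun _ => √(Var[psi P X Y β₀ k 0; P])) := by
  have hW := h.isCompactIID hsupp
  have hg : Continuous (Function.uncurry
      fun (w : Covariates T p × Outcomes T) θ => influence k w θ ^ 2) :=
    (continuous_influence k).pow 2
  have hψ : AEMeasurable (psi P X Y β₀ k 0) P :=
    by
    rw [psi_eq]
    exact ((continuous_influence_left k _).measurable.comp (hW.measurable 0)).aemeasurable
  refine tendstoInMeasure_of_tendsto_ae (fun n => ?_) ?_
  · unfold sigmaHat
    simp only [psiHat_eq]
    exact (aemeasurable_mean_comp hW hg
      (aemeasurable_influenceArgHat hW (hβm n)) n).sqrt.aestronglyMeasurable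
  · have hθ : ∀ᵐ ω ∂P, Tendsto (fun n => influenceArgHat X Y βhat n ω) atTop
        (𝓝 (influenceArg P X Y β₀)) := by
      filter_upwards [hβ, tendsto_pMean hW hβ, tendsto_pGradMean hW hβ,
        tendsto_informationHat hW hβ] with ω h1 h2 h3 h4
      have h5 := (tendsto_inv_apply (h.isUnit_information hsupp hvar) h4).2
      exact h1.prodMk_nhds (h2.prodMk_nhds ((tendsto_pi_nhds.2 h3).prodMk_nhds
        (tendsto_pi_nhds.2 fun j => tendsto_pi_nhds.2 fun l => h5 j l)))
    rw [variance_of_integral_eq_zero hψ (h.integral_psi hsupp k)]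
    filter_upwards [hW.tendsto_mean_comp hg hθ] with ω hω
    simp only [sigmaHat, psiHat_eq, psi_eq, Function.comp_apply]
    exact (Real.continuous_sqrt.tendsto _).comp hω

/-- The asymptotically linear representation of the estimator. -/
theorem IsSample.tendstoInMeasure_linearization (h : IsSample P X α ε Y β₀)
    (hsupp : IsCompact (P.map (X 0)).support) (hvar : IsUnit (variationMatrix P (X 0)))
    (hβm : ∀ n, AEMeasurable (βhat n) P)
    (hβ : ∀ᵐ ω ∂P, Tendsto (fun n => βhat n ω) atTop (𝓝 β₀) ∧
      ∀ᶠ n in atTop, ∀ j, ∑ i ∈ Finset.range n,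
        grad (condLogLik (Y i ω) (X i ω)) (βhat n ω) j = 0) (k : Fin p) :
    TendstoInMeasure P
      (fun (n : ℕ) ω => √(n : ℝ) * (deltaHat X Y βhat k n ω - deltaTilde P (X 0) (Y 0) β₀ k) -
        (1 / √(n : ℝ)) * ∑ i ∈ Finset.range n, psi P X Y β₀ k i ω) atTop (fun _ => 0) := by
  have hW := h.isCompactIID hsupp
  have hβl : ∀ᵐ ω ∂P, Tendsto (fun n => βhat n ω) atTop (𝓝 β₀) := hβ.mono fun ω hω => hω.1
  let S : Fin p → Covariates T p × Outcomes T → ℝ := fun j w => grad (condLogLik w.2 w.1) β₀ j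
  have hSc : ∀ j, Continuous (S j) := fun j => continuous_score_left β₀ j
  let Z : Fin p → ℕ → Ω → ℝ := fun j n ω =>
    (1 / √(n : ℝ)) * ∑ i ∈ Finset.range n, S j (X i ω, Y i ω)
  have hZ : ∀ j n, Integrable (fun ω => Z j n ω ^ 2) P ∧
      ∫ ω, Z j n ω ^ 2 ∂P ≤ ∫ ω, S j (X 0 ω, Y 0 ω) ^ 2 ∂P := fun j n =>
    integral_sq_normalized_sum (Z := fun i ω => S j (X i ω, Y i ω))
      (hW.indep.comp (fun _ => S j) fun _ => (hSc j).measurable)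
      (fun i => (hW.ident i).comp (hSc j).measurable) (hW.memLp_comp (hSc j) 2)
      (h.integral_score hsupp j) n
  have hSm : ∀ j i, Measurable fun ω => S j (X i ω, Y i ω) := fun j i =>
    (hSc j).measurable.comp (hW.measurable i)
  have hZm : ∀ j n, Measurable (Z j n) := fun j n =>
    (Finset.measurable_fun_sum _ fun i _ => hSm j i).const_mul _
  have hψm : ∀ i, Measurable (psi P X Y β₀ k i) := fun i => by
    rw [psi_eq]
    exact (continuous_influence_left k _).measurable.comp (hW.measurable i)
  -- Cauchy-Schwarz reduces the `L²` bound for the vector of normalized scores to its coordinates.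
  have hNsq : ∀ n ω, (∑ j, |Z j n ω|) ^ 2 ≤ p * ∑ j, Z j n ω ^ 2 := by
    intro n ω
    have := sq_sum_le_card_mul_sum_sq (s := Finset.univ) (f := fun j => |Z j n ω|)
    simpa using this
  have hNm : ∀ n, Measurable fun ω => ∑ j, |Z j n ω| := fun n =>
    Finset.measurable_fun_sum _ fun j _ => (hZm j n).abs
  have hNi : ∀ n, Integrable (fun ω => (p : ℝ) * ∑ j, Z j n ω ^ 2) P := fun n =>
    (integrable_finsetSum _ fun j _ => (hZ j n).1).const_mul _
  have hNint : ∀ n, Integrable (fun ω => (∑ j, |Z j n ω|) ^ 2) P := fun n => by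
    refine (hNi n).mono ((hNm n).pow_const 2).aestronglyMeasurable (ae_of_all _ fun ω => ?_)
    rw [Real.norm_of_nonneg (sq_nonneg _)]
    exact (hNsq n ω).trans (le_abs_self _)
  refine tendstoInMeasure_zero_of_div_tendsto (N := fun n ω => ∑ j, |Z j n ω|)
    (C := p * ∑ j, ∫ ω, S j (X 0 ω, Y 0 ω) ^ 2 ∂P) (fun n => ?_)
    (fun n => (hNm n).aemeasurable) (fun n ω => Finset.sum_nonneg fun j _ => abs_nonneg _)
    hNint (fun n => ?_) ?_
  · exact (((aemeasurable_deltaHat hW (hβm n) k).sub_const _).const_mul _).sub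
      ((Finset.aemeasurable_fun_sum _ fun i _ => (hψm i).aemeasurable).const_mul _)
  · refine (integral_mono (hNint n) (hNi n) (hNsq n)).trans ?_
    rw [integral_const_mul, integral_finsetSum _ fun j _ => (hZ j n).1]
    exact mul_le_mul_of_nonneg_left (Finset.sum_le_sum fun j _ => (hZ j n).2) (Nat.cast_nonneg p)
  set m := ∫ ω', pFun (X 0 ω') (numOnes (Y 0 ω')) β₀ ∂P with hm
  set v : Fin p → ℝ := fun j => ∫ ω', grad (pFun (X 0 ω') (numOnes (Y 0 ω'))) β₀ j ∂P with hv
  set J := (information P (X 0) (Y 0) β₀)⁻¹ with hJ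
  -- Slopes between `β₀` and `β̂` average to derivatives at `β₀`, because a slope with coinciding
  -- endpoints is the derivative.
  have hslopeS : ∀ᵐ ω ∂P, ∀ j l, Tendsto (fun n : ℕ => (1 / (n : ℝ)) * ∑ i ∈ Finset.range n,
      slopeFun (fun b => grad (condLogLik (Y i ω) (X i ω)) b j) β₀ (βhat n ω) l) atTop
      (𝓝 (∫ ω, hess (condLogLik (Y 0 ω) (X 0 ω)) β₀ j l ∂P)) := by
    refine ae_all_iff.2 fun j => ae_all_iff.2 fun l => ?_
    have := hW.tendsto_mean_comp (continuous_slopeFun_score (β₀ := β₀) j l) hβl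
    simp only [slopeFun_self] at this
    exact this
  have hslopeP : ∀ᵐ ω ∂P, ∀ l, Tendsto (fun n : ℕ => (1 / (n : ℝ)) * ∑ i ∈ Finset.range n,
      slopeFun (pFun (X i ω) (numOnes (Y i ω))) β₀ (βhat n ω) l) atTop (𝓝 (v l)) := by
    refine ae_all_iff.2 fun l => ?_
    have := hW.tendsto_mean_comp (continuous_slopeFun_pFun (β₀ := β₀) l) hβl
    simp only [slopeFun_self] at this
    exact this
  filter_upwards [hβ, hslopeS, hslopeP, tendsto_pMean hW hβl] with ω ⟨_, hfoc⟩ hS hP hpm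
  let M : ℕ → Matrix (Fin p) (Fin p) ℝ := fun n => Matrix.of fun j l =>
    -((1 / (n : ℝ)) * ∑ i ∈ Finset.range n,
      slopeFun (fun b => grad (condLogLik (Y i ω) (X i ω)) b j) β₀ (βhat n ω) l)
  let G : ℕ → Fin p → ℝ := fun n l => (1 / (n : ℝ)) * ∑ i ∈ Finset.range n,
      slopeFun (pFun (X i ω) (numOnes (Y i ω))) β₀ (βhat n ω) l
  obtain ⟨hdet, hinv⟩ := tendsto_inv_apply (M := M) (h.isUnit_information hsupp hvar)
    fun j l => (hS j l).neg
  -- These are the coefficients supplied by `expansion_eq`: estimated minus limiting loading of each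
  -- normalized score.
  let c : ℕ → Fin p → ℝ := fun n j => pMean X Y βhat n ω * (M n)⁻¹ k j - m * J k j +
    β₀ k * (∑ l, G n l * (M n)⁻¹ l j - ∑ l, v l * J l j)
  have hc : ∀ j, Tendsto (fun n => c n j) atTop (𝓝 0) := by
    intro j
    have h1 : Tendsto (fun n => c n j) atTop (𝓝 (m * J k j - m * J k j +
        β₀ k * (∑ l, v l * J l j - ∑ l, v l * J l j))) :=
      ((hpm.mul (hinv k j)).sub_const _).add (((tendsto_finsetSum _ fun l _ =>
        (hP l).mul (hinv l j)).sub_const _).const_mul _)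
    simpa using h1
  have hD : ∀ᶠ n : ℕ in atTop, √(n : ℝ) * (deltaHat X Y βhat k n ω -
      deltaTilde P (X 0) (Y 0) β₀ k) - (1 / √(n : ℝ)) * ∑ i ∈ Finset.range n, psi P X Y β₀ k i ω =
      ∑ j, c n j * Z j n ω := by
    filter_upwards [hfoc, hdet, eventually_gt_atTop 0] with n hfn hdn hn
    have hs : ∀ j, (1 / (n : ℝ)) * ∑ i ∈ Finset.range n, S j (X i ω, Y i ω) =
        (M n).mulVec (βhat n ω - β₀) j := by
      intro j
      -- Hadamard's lemma applied to the score; summing over `i`, the score at `β̂` drops out by the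
      -- first order condition.
      have h1 : ∀ i, S j (X i ω, Y i ω) = grad (condLogLik (Y i ω) (X i ω)) (βhat n ω) j -
          ∑ l, slopeFun (fun b => grad (condLogLik (Y i ω) (X i ω)) b j) β₀ (βhat n ω) l *
            (βhat n ω l - β₀ l) := by
        intro i
        have hsm := contDiff_of_uncurry (contDiff_grad (contDiff_condLogLik (Y i ω)) j) (X i ω)
        rw [← sub_eq_sum_slopeFun hsm]
        exact (sub_sub_cancel _ _).symm
      simp only [h1, Finset.sum_sub_distrib, hfn j, Matrix.mulVec, dotProduct, M, Matrix.of_apply,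
        Pi.sub_apply]
      rw [zero_sub, mul_neg, Finset.sum_comm, Finset.mul_sum, ← Finset.sum_neg_distrib]
      refine Finset.sum_congr rfl fun l _ => ?_
      rw [← Finset.sum_mul]
      ring
    have hp : pMean X Y βhat n ω - (1 / (n : ℝ)) * ∑ i ∈ Finset.range n,
        pFun (X i ω) (numOnes (Y i ω)) β₀ = ∑ l, G n l * (βhat n ω - β₀) l := by
      rw [pMean, ← mul_sub, ← Finset.sum_sub_distrib]
      simp only [sub_eq_sum_slopeFun (contDiff_of_uncurry (contDiff_pFun (Y _ ω)) (X _ ω)), G,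
        Pi.sub_apply]
      rw [Finset.sum_comm, Finset.mul_sum]
      refine Finset.sum_congr rfl fun l _ => ?_
      rw [← Finset.sum_mul]
      ring
    have hexp := expansion_eq (J := J) (v := v) (b := β₀ k) (m := m) hn k hdn hs hp
    rw [← hexp, deltaTilde_eq hW, ← hm, deltaHat, Pi.sub_apply, add_sub_cancel]
    rfl
  have hcs : Tendsto (fun n => ∑ j, |c n j|) atTop (𝓝 0) := by
    have := tendsto_finsetSum Finset.univ fun j _ => (hc j).abs
    simpa using this
  refine squeeze_zero_norm' ?_ hcs
  filter_upwards [hD] with n hn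
  have hN0 : 0 ≤ ∑ j, |Z j n ω| := Finset.sum_nonneg fun j _ => abs_nonneg _
  rw [hn, Real.norm_eq_abs, abs_div, abs_of_pos (by linarith : 0 < 1 + ∑ j, |Z j n ω|),
    div_le_iff₀ (by linarith)]
  calc |∑ j, c n j * Z j n ω| ≤ ∑ j, |c n j * Z j n ω| := Finset.abs_sum_le_sum_abs _ _
    _ ≤ ∑ j, |c n j| * (1 + ∑ j, |Z j n ω|) := by
        refine Finset.sum_le_sum fun j _ => ?_
        rw [abs_mul]
        refine mul_le_mul_of_nonneg_left ?_ (abs_nonneg _)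
        have := Finset.single_le_sum (f := fun j => |Z j n ω|) (fun j _ => abs_nonneg _)
          (Finset.mem_univ j)
        linarith
    _ = _ := by rw [Finset.sum_mul]

end Asymptotics

end FELogit

/-! ### The main theorem -/

theorem lemma2 {Ω : Type*} [MeasurableSpace Ω] (P : Measure Ω) [IsProbabilityMeasure P]
    {T p : ℕ} [NeZero T]
    (X : ℕ → Ω → FELogit.Covariates T p) (α : ℕ → Ω → ℝ) (ε : ℕ → Ω → Fin T → ℝ)
    (Y : ℕ → Ω → FELogit.Outcomes T) (β₀ : Fin p → ℝ)
    (hmodel : FELogit.IsSample P X α ε Y β₀)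
    (hvar : IsUnit (FELogit.variationMatrix P (X 0)))
    (hsupp : IsCompact (P.map (X 0)).support)
    (Θ : Set (Fin p → ℝ)) (hΘ : β₀ ∈ interior Θ)
    (βhat : ℕ → Ω → Fin p → ℝ) (hβhat : FELogit.IsCMLE P X Y Θ βhat)
    (k : Fin p) :
    -- the objects in the statement are well defined
    IsUnit (FELogit.information P (X 0) (Y 0) β₀) ∧
    MemLp (FELogit.psi P X Y β₀ k 0) 2 P ∧
    -- the expressions of `Δ̃`
    FELogit.deltaTilde P (X 0) (Y 0) β₀ k =
      β₀ k * ∫ ω, FELogit.pFun (X 0 ω) (FELogit.numOnes (Y 0 ω)) β₀ ∂P ∧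
    (∀ μ : FELogit.Covariates T p → Measure ℝ, FELogit.IsMomentFamily P (X 0) (Y 0) β₀ μ →
      FELogit.deltaTilde P (X 0) (Y 0) β₀ k =
        ∫ ω, (FELogit.rFun k (X 0 ω) (FELogit.numOnes (Y 0 ω)) β₀ +
          β₀ k * FELogit.cX P (X 0) (Y 0) β₀ 0 ω * FELogit.lam (T + 1) (X 0 ω) β₀ *
            ∫ u, (FELogit.bestApprox T).eval u ∂(μ (X 0 ω))) ∂P) ∧
    -- `ψ` is the influence function of `Δ̂`
    TendstoInMeasure P
      (fun (n : ℕ) ω => √(n : ℝ) * (FELogit.deltaHat X Y βhat k n ω -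
          FELogit.deltaTilde P (X 0) (Y 0) β₀ k) -
        (1 / √(n : ℝ)) * ∑ i ∈ Finset.range n, FELogit.psi P X Y β₀ k i ω)
      atTop (fun _ => 0) ∧
    -- asymptotic normality, with `σ² = V(ψ)`
    TendstoInDistribution
      (fun (n : ℕ) ω => √(n : ℝ) * (FELogit.deltaHat X Y βhat k n ω -
        FELogit.deltaTilde P (X 0) (Y 0) β₀ k))
      atTop id (fun _ => P)
      (gaussianReal 0 (Var[FELogit.psi P X Y β₀ k 0; P]).toNNReal) ∧
    -- consistency of `σ̂`
    TendstoInMeasure P (fun n => FELogit.sigmaHat X Y βhat k n) atTop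
      (fun _ => √(Var[FELogit.psi P X Y β₀ k 0; P])) := by
  have hW := hmodel.isCompactIID hsupp
  have hψc := FELogit.continuous_influence_left (T := T) k (FELogit.influenceArg P X Y β₀)
  have hcmle := hmodel.tendsto_cmle hsupp hvar hΘ hβhat
  have hβm : ∀ n, AEMeasurable (βhat n) P := fun n => (hβhat n).1
  have hψL : MemLp (FELogit.psi P X Y β₀ k 0) 2 P := hW.memLp_comp hψc 2
  have hlin := hmodel.tendstoInMeasure_linearization hsupp hvar hβm hcmle k
  refine ⟨hmodel.isUnit_information hsupp hvar, hψL, FELogit.deltaTilde_eq hW k,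
    fun μ hμ => FELogit.deltaTilde_eq_moment hW k hμ, hlin, ?_,
    hmodel.tendstoInMeasure_sigmaHat hsupp hvar hβm (hcmle.mono fun ω hω => hω.1) k⟩
  have hclt := tendstoInDistribution_inv_sqrt_mul_sum_sub (P := P)
    (P' := gaussianReal 0 (Var[FELogit.psi P X Y β₀ k 0; P]).toNNReal) (Y := id)
    (X := FELogit.psi P X Y β₀ k) HasLaw.id hψL
    (hW.indep.comp (fun _ => _) fun _ => hψc.measurable)
    (fun i => (hW.ident i).comp hψc.measurable)
  rw [hmodel.integral_psi hsupp k] at hclt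
  -- Slutsky: the estimator differs from the normalized sum of influence functions by `o_P(1)`, so
  -- it inherits the limit of that sum.
  refine tendstoInDistribution_of_tendstoInMeasure_sub _ _ hclt ?_ fun n =>
    ((FELogit.aemeasurable_deltaHat hW (hβm n) k).sub_const _).const_mul _
  convert hlin using 1
  · funext n ω
    simp [one_div]
  · rfl
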